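/- **Setting.** Let $G=(\mathcal V,\mathcal E)$ be a finite connected simple graph, let $\mu$ be a probability on $\mathcal V$ with full support, and let $\mathcal S=\prod_{v}S_{\mathcal E(v)}$ be the set of lists of preferences ($S_{\mathcal E(v)}$ is the permutation group of the set $\mathcal E(v)$ of neighbours of $v$). Items arrive one by one. An admissible (greedy) matching policy $\phi$ consists of a probability $\nu_\phi$ on $\mathcal S$ and of a rule which, from the word $w$ of the classes of the stored items in order of arrival, the class $v$ of the arriving item and its list of preferences $\sigma\in\mathcal S$, selects a stored item of a class compatible with $v$ (adjacent to $v$ in $G$) if there is one; then the two items are matched and leave. Otherwise the arriving item is stored. The new word is denoted $w\odot_\phi(v,\sigma)$. For a word $z\in\mathcal V^*$ and a word $\varsigma\in\mathcal S^*$ of the same length, $W_\phi(z,\varsigma)$ is the word of the items left in a system that is started empty and fed by $(z,\varsigma)$; $\phi$ is sub-additive if $|W_\phi(z'z'',\varsigma'\varsigma'')|\le|W_\phi(z',\varsigma')|+|W_\phi(z'',\varsigma'')|$ for all such pairs $(z',\varsigma')$, $(z'',\varsigma'')$ whose lists of preferences belong to the support of $\nu_\phi$. Let $\mathbb W_2$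 be the set of words of even length over $\mathcal V$ no two letters of which are adjacent in $G$. Let $\Omega^0=(\mathcal V\times\mathcal S\times\mathcal V\times\mathcal S)^{\mathbb Z}$, with the product law $\mathbf P$ under which all coordinates are independent, the classes of law $\mu$ and the lists of law $\nu_\phi$, and with the shift $\theta$. At each time $n\in\mathbb Z$ two items enter, first $(V^0,\Sigma^0)\circ\theta^n$ and then $(V^1,\Sigma^1)\circ\theta^n$. For a $\mathbb W_2$-valued random variable $Y$ on $\Omega^0$ let $U^{\{Y\}}_0=Y$, $U^{\{Y\}}_{n+1}=(U^{\{Y\}}_n\odot_\phi(V^0,\Sigma^0)\circ\theta^n)\odot_\phi(V^1,\Sigma^1)\circ\theta^n$, and let $\tau_1(Y)=\inf\{n>0: U_n^{\{Y\}}=\emptyset\}$. Condition (H1) for $Y$ says that $\tau_1(Y)$ is integrable. A bi-infinite $\phi$-matching (at even times) of an input $\omega\in\Omega^0$ is a graph on the set of all arriving items in which every node has degree at most $1$, such that just before each arrival the set of stored items (those that arrived before and have no neighbour among the items that arrived before) is finite, each arriving item is matched with the stored item selected by $\phi$, or with none of the earlier items if $\phi$ stores it, and the number of stored items is even at all times $n\in\mathbb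 Z$ (just before the two arrivals of time $n$). It is perfect if every node has degree $1$. A stationary perfect bi-infinite $\phi$-matching is a random graph $M$ on $\Omega^0$ which is almost surely a perfect bi-infinite $\phi$-matching of the input and is compatible with the shift: almost surely, $M\circ\theta$ is $M$ with the items renumbered by the shift. **Theorem.** Assume that $\phi$ is sub-additive and that (H1) holds for every bounded $\mathbb W_2$-valued random variable $Y$ on $\Omega^0$. Then there exists a stationary perfect bi-infinite $\phi$-matching $M$, and: 1. *(uniqueness)* every stationary perfect bi-infinite $\phi$-matching coincides almost surely with $M$. Moreover, almost surely, $M$ is the only perfect bi-infinite $\phi$-matching of the input, stationary or not, for which the number of stored items at time $-n$ does not tend to $\infty$ as $n\to\infty$. 2. *(construction points)* There is an almost surely unique $\mathbb W_2$-valued random variable $U^*$ with $U^*\circ\theta=(U^*\odot_\phi(V^0,\Sigma^0))\odot_\phi(V^1,\Sigma^1)$ almost surely. Almost surely the set of construction points $\{n\in\mathbb Z: U^*\circ\theta^n=\emptyset\}$ is unbounded below and above, and $M$ is the union, over all pairs $c<c'$ of consecutive construction points, of the matchings obtained by starting empty at time $c$ and matching by $\phi$ the items that enter at the times $c,\dots,c'-1$.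 3. *(limit)* Let $Y$ be any $\mathbb W_2$-valued random variable that satisfies (H1), for instance any bounded one, and let $\mathbf M_\infty^{\{Y,-k\}}(\phi)$ be the infinite matching by $\phi$ of the items initially stored at time $-k$, whose classes are given by $Y\circ\theta^{-k}$, and of all the items that enter from time $-k$ on. Then $\mathbf M_\infty^{\{Y,-k\}}(\phi)$ converges almost surely to $M$ as $k\to\infty$: almost surely, for every $m\in\mathbb Z$ and all large enough $k$, every item that enters from time $m$ on has the same match in $\mathbf M_\infty^{\{Y,-k\}}(\phi)$ as in $M$. -/

import Mathlib

open MeasureTheory Filter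
open scoped ENNReal

namespace StochMatching

universe u

/-- A list of preferences: for every class `v`, a permutation of the set of classes that are
compatible with `v`. -/
def PrefList {V : Type u} (G : SimpleGraph V) : Type u :=
  (v : V) → Equiv.Perm (G.neighborSet v)

/-- `PrefList G` is finite when `V` is; it carries the discrete sigma-algebra. -/
instance {V : Type u} (G : SimpleGraph V) : MeasurableSpace (PrefList G) := ⊤

/-- An arriving item: its class and the list of preferences drawn upon its arrival. -/
abbrev Item {V : Type u} (G : SimpleGraph V) : Type u := V × PrefList G

/-- An admissible (greedy) matching policy `φ` on the compatibility graph `G`: the law `ν_φ` of the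
lists of preferences, and the choice of the match of an incoming item, which depends only on the
queue detail `w` (the word of the classes of the stored items, in order of arrival), on the class
`v` of the incoming item and on its list of preferences. The value `some i` means that the incoming
item is matched with the stored item at position `i` of `w` (which must be compatible), the value
`none` that the incoming item is stored (which happens only if no stored item is compatible). -/
structure Policy {V : Type u} (G : SimpleGraph V) where
  prefLaw : PMF (PrefList G)
  choice : (w : List V) → V → PrefList G → Option (Fin w.length)
  adj_of_some : ∀ (w : List V) (v : V) (σ : PrefList G) (i : Fin w.length),
    choice w v σ = some i → G.Adj v (w.get i)
  not_adj_of_none : ∀ (w : List V) (v : V) (σ : PrefList G),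
    choice w v σ = none → ∀ a ∈ w, ¬ G.Adj v a

section Dynamics

variable {V : Type u} {G : SimpleGraph V}

/-- The action `w ⊙_φ (v, σ)` of an arrival on the queue detail. -/
def Policy.act (φ : Policy G) (w : List V) (x : Item G) : List V :=
  match φ.choice w x.1 x.2 with
  | none => w ++ [x.1]
  | some i => w.eraseIdx i

/-- `W_φ(z, ς)`: the queue detail of a system that starts empty and is fed by the word `z`
(each letter coming with its list of preferences). -/
def Policy.queue (φ : Policy G) (z : List (Item G)) : List V :=
  z.foldl φ.act []

/-- Sub-additivity of a matching policy. -/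
def Policy.SubAdditive (φ : Policy G) : Prop :=
  ∀ z' z'' : List (Item G),
    (∀ x ∈ z', x.2 ∈ φ.prefLaw.support) → (∀ x ∈ z'', x.2 ∈ φ.prefLaw.support) →
    (φ.queue (z' ++ z'')).length ≤ (φ.queue z').length + (φ.queue z'').length

/-- The set `𝕎₂` of admissible queue details of even length: words in which no two letters are
compatible. -/
def EvenQueue (G : SimpleGraph V) : Set (List V) :=
  {w | (∀ a ∈ w, ∀ b ∈ w, ¬ G.Adj a b) ∧ Even w.length}

/-- The canonical space of the input at even times: at each time `n : ℤ`, a first and then a second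
item arrive. -/
abbrev Input (G : SimpleGraph V) : Type u := ℤ → Item G × Item G

/-- The `n`-th iterate `θ^n` of the shift. -/
def shift (n : ℤ) (ω : Input G) : Input G := fun k => ω (k + n)

/-- The law of the input: all classes have law `μ`, all lists of preferences have law `ν_φ`, and
everything is independent. -/
noncomputable def inputLaw [MeasurableSpace V] (μ : PMF V) (φ : Policy G) : Measure (Input G) :=
  Measure.infinitePi fun _ : ℤ =>
    (μ.toMeasure.prod φ.prefLaw.toMeasure).prod (μ.toMeasure.prod φ.prefLaw.toMeasure)

/-- The transition of the even buffer content over one time slot. -/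
def Policy.evenStep (φ : Policy G) (w : List V) (s : Item G × Item G) : List V :=
  φ.act (φ.act w s.1) s.2

/-- `𝕎₂`-valued random variables on the canonical space (`List V` is countable). -/
def IsQueueRV [MeasurableSpace V] (Y : Input G → List V) : Prop :=
  (∀ w : List V, MeasurableSet {ω | Y ω = w}) ∧ ∀ ω, Y ω ∈ EvenQueue G

/-- The set of bounded `𝕎₂`-valued random variables, that is, those with values in
`𝕎₂(r) = {w ∈ 𝕎₂ : |w| ≤ 2r}` for some `r`. -/
def IsBoundedQueueRV [MeasurableSpace V] (Y : Input G → List V) : Prop :=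
  IsQueueRV Y ∧ ∃ r : ℕ, ∀ ω, (Y ω).length ≤ 2 * r

/-- The even buffer content `U_n^{Y}`. -/
def Policy.evenBuffer (φ : Policy G) (Y : Input G → List V) (ω : Input G) : ℕ → List V
  | 0 => Y ω
  | n + 1 => φ.evenStep (φ.evenBuffer Y ω n) (ω n)

/-- `τ₁(Y)`: the first time `n > 0` at which `U_n^{Y}` is empty (`∞` if there is none). -/
noncomputable def Policy.firstEmpty (φ : Policy G) (Y : Input G → List V) (ω : Input G) : ℝ≥0∞ :=
  ⨅ (n : ℕ) (_ : 0 < n ∧ φ.evenBuffer Y ω n = []), (n : ℝ≥0∞)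

/-- Condition (H1) for the initial condition `Y`: `τ₁(Y)` is integrable. -/
def Policy.H1 [MeasurableSpace V] (φ : Policy G) (μ : PMF V) (Y : Input G → List V) : Prop :=
  ∫⁻ ω, φ.firstEmpty Y ω ∂(inputLaw μ φ) < ⊤

/-- A stationary even buffer content: a `𝕎₂`-valued random variable `U` with
`U ∘ θ = (U ⊙_φ (V⁰, Σ⁰)) ⊙_φ (V¹, Σ¹)` almost surely. -/
def Policy.IsStationaryBuffer [MeasurableSpace V] (φ : Policy G) (μ : PMF V)
    (U : Input G → List V) : Prop :=
  IsQueueRV U ∧ ∀ᵐ ω ∂(inputLaw μ φ), U (shift 1 ω) = φ.evenStep (U ω) (ω 0)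

end Dynamics

section Matchings

variable {V : Type u} {G : SimpleGraph V}

/-- Arriving items are numbered by `ℤ`: at (even) time `n` enter the items `2n` and `2n + 1`. -/
def itemAt (ω : Input G) (t : ℤ) : Item G :=
  if Even t then (ω (t / 2)).1 else (ω (t / 2)).2

/-- The nodes of a matching that starts from a non-empty buffer: `Sum.inl i` is the initially
stored item at position `i`, and `Sum.inr t` is the arriving item number `t`. -/
abbrev Node : Type := ℕ ⊕ ℤ

/-- The buffer, with the identity of the stored items, just before the arrival of item `2m + j`, in
the system that starts at time `m` with the stored items of classes `y`. -/
def Policy.labelledBuffer (φ : Policy G) (y : List V) (m : ℤ) (ω : Input G) :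
    ℕ → List (Node × V)
  | 0 => y.zipIdx.map fun p => (Sum.inl p.2, p.1)
  | j + 1 =>
    let b := φ.labelledBuffer y m ω j
    let x := itemAt ω (2 * m + j)
    match φ.choice (b.map Prod.snd) x.1 x.2 with
    | none => b ++ [(Sum.inr (2 * m + j), x.1)]
    | some i => b.eraseIdx i

/-- In the same system, `z` is the stored item with which item `2m + j` is matched upon arrival. -/
def Policy.MatchedUponArrival (φ : Policy G) (y : List V) (m : ℤ) (ω : Input G) (j : ℕ)
    (z : Node) : Prop :=
  ∃ i : Fin ((φ.labelledBuffer y m ω j).map Prod.snd).length,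
    φ.choice ((φ.labelledBuffer y m ω j).map Prod.snd)
      (itemAt ω (2 * m + j)).1 (itemAt ω (2 * m + j)).2 = some i ∧
    ((φ.labelledBuffer y m ω j).map Prod.fst)[(i : ℕ)]? = some z

/-- The finite matching `𝐌_n^{y,m}(φ)` of the initially stored items, of classes `y`, and of the
items that enter from time `m` on and before time `n`. (All other nodes are isolated.) -/
def Policy.finiteMatching (φ : Policy G) (y : List V) (m n : ℤ) (ω : Input G) :
    SimpleGraph Node :=
  SimpleGraph.fromRel fun x z => ∃ j : ℕ, 2 * m + (j : ℤ) < 2 * n ∧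
    x = Sum.inr (2 * m + (j : ℤ)) ∧ φ.MatchedUponArrival y m ω j z

/-- The infinite matching `𝐌_∞^{y,m}(φ)`: the increasing limit of the finite matchings. -/
def Policy.infiniteMatching (φ : Policy G) (y : List V) (m : ℤ) (ω : Input G) :
    SimpleGraph Node :=
  ⨆ n : ℤ, φ.finiteMatching y m n ω

/-- The construction points associated with `U`: the times `n` at which `U ∘ θ^n` is empty. -/
def constructionPoints (U : Input G → List V) (ω : Input G) : Set ℤ :=
  {n | U (shift n ω) = []}

/-- The stationary bi-infinite matching: the union, over all pairs `c < c'` of consecutive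
construction points, of the matchings, started empty, of the items that enter from time `c` on and
before time `c'`. -/
def Policy.stationaryMatching (φ : Policy G) (U : Input G → List V) (ω : Input G) :
    SimpleGraph ℤ :=
  ⨆ (c : ℤ) (c' : ℤ) (_ : c ∈ constructionPoints U ω ∧ c' ∈ constructionPoints U ω ∧ c < c' ∧
      ∀ n ∈ constructionPoints U ω, n ≤ c ∨ c' ≤ n),
    (φ.finiteMatching [] c c' ω).comap Sum.inr

/-- The items that are in the buffer just before the arrival of item `t`, if the matches between
items are given by the graph `H`. -/
def stored (H : SimpleGraph ℤ) (t : ℤ) : Set ℤ :=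
  {s | s < t ∧ ∀ r < t, ¬ H.Adj s r}

open Classical in
/-- The list, in order of arrival, of the items of `stored H t` (when there are finitely many). -/
noncomputable def storedList (H : SimpleGraph ℤ) (t : ℤ) : List ℤ :=
  if h : (stored H t).Finite then h.toFinset.sort (· ≤ ·) else []

/-- The graph `H` is a bi-infinite `φ`-matching, at even times, of the items of the input `ω`: every
item has at most one match, the buffer is always finite, every item is matched upon its arrival as
prescribed by the policy (and if it is stored then, with none of the items that came before it),
and at even times the buffer contains an even number of items. -/
structure Policy.IsBiinfiniteMatching (φ : Policy G) (ω : Input G) (H : SimpleGraph ℤ) : Prop where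
  eq_of_adj : ∀ s t t' : ℤ, H.Adj s t → H.Adj s t' → t = t'
  finite_stored : ∀ t : ℤ, (stored H t).Finite
  adj_iff : ∀ s t : ℤ, s < t →
    (H.Adj s t ↔
      ∃ i : Fin ((storedList H t).map fun r => (itemAt ω r).1).length,
        φ.choice ((storedList H t).map fun r => (itemAt ω r).1) (itemAt ω t).1 (itemAt ω t).2
            = some i ∧
          (storedList H t)[(i : ℕ)]? = some s)
  even_stored : ∀ n : ℤ, Even (storedList H (2 * n)).length

/-- A matching is perfect if every item is matched. -/
def IsPerfect (H : SimpleGraph ℤ) : Prop :=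
  ∀ s : ℤ, ∃ t : ℤ, H.Adj s t

/-- A stationary perfect bi-infinite `φ`-matching at even times: a random graph that is almost
surely a perfect bi-infinite `φ`-matching of the input, and is compatible with the shift. -/
structure Policy.IsStationaryPerfectMatching [MeasurableSpace V] (φ : Policy G) (μ : PMF V)
    (M : Input G → SimpleGraph ℤ) : Prop where
  measurable : ∀ s t : ℤ, MeasurableSet {ω | (M ω).Adj s t}
  isBiinfiniteMatching : ∀ᵐ ω ∂(inputLaw μ φ), φ.IsBiinfiniteMatching ω (M ω)
  isPerfect : ∀ᵐ ω ∂(inputLaw μ φ), IsPerfect (M ω)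
  stationary : ∀ᵐ ω ∂(inputLaw μ φ), ∀ s t : ℤ,
    (M (shift 1 ω)).Adj s t ↔ (M ω).Adj (s + 2) (t + 2)

end Matchings

end StochMatching

/-!
A stationary matching is built by coupling from the past. The argument has a pathwise part, for inputs that are "good"
(`Policy.IsGoodInput`), and a probabilistic part, which shows that almost every input is good.

*Almost every input is good.* By (H1) for a constant initial content `w`, the probabilities that the
system started at time `-k` with `w` has not yet been empty again at time `j` have a finite sum
over `k`, so by Borel–Cantelli all but finitely many of these systems are emptied before `j`
(`Policy.H1.ae_eventually_empty`). Applied to the empty content, this shows that the contents at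
time `0` of all the systems started empty at negative times form a finite set
(`Policy.exists_length_flow_le`). To make these systems merge, one needs words that empty the buffer
whatever it contained. Such words exist if the graph is not bipartite: two non-adjacent classes
are joined by a walk of odd length, and the letters along the walk, taken in pairs of neighbours,
erase them (`Policy.exists_erases_of_odd_walk`); sub-additivity then gives one word that erases
every content of bounded length (`Policy.exists_erases`). The graph cannot be bipartite, because a
long run of a single class would change the difference between the numbers of stored items of the
two colors by an arbitrarily large amount, against the finiteness above
(`Policy.not_colorable_two`). By independence, with positive probability the contents at time `n`
are bounded by the appropriate constant and an erasing word enters from time `n` on; by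
Kolmogorov's zero-one law this happens for infinitely many `n < 0`, and Poincaré recurrence gives
the positive times (`Policy.ae_isGoodInput`).

*Good inputs.* The systems started empty in a remote past have a common content at each time
(`Policy.limitBuffer`), which vanishes at arbitrarily remote times in both directions. Every
trajectory of the buffer over all of `ℤ` whose length does not tend to infinity at `-∞` coincides
with it (`Policy.IsGoodInput.pastLimit_of_not_tendsto`). A bi-infinite matching is the same thing as
a trajectory of the list of the stored items, and such a trajectory is determined by its emptiness
at remote times in the past; this gives existence, uniqueness and the limit statement
(`Policy.IsGoodInput.eq_stationaryMatching`,
`Policy.IsGoodInput.eventually_infiniteMatching_adj`). For a stationary buffer content or matching,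
the non-transience at `-∞` is Poincaré recurrence.
-/

namespace StochMatching


/-! ### Dynamics of the buffer content -/

section Dynamics

variable {V : Type*} {G : SimpleGraph V} (φ : Policy G)

theorem Policy.act_of_none {w : List V} {x : Item G} (h : φ.choice w x.1 x.2 = none) :
    φ.act w x = w ++ [x.1] := by
  simp [Policy.act, h]

theorem Policy.act_of_some {w : List V} {x : Item G} {i : Fin w.length}
    (h : φ.choice w x.1 x.2 = some i) : φ.act w x = w.eraseIdx i := by
  simp [Policy.act, h]

theorem Policy.act_nil (x : Item G) : φ.act [] x = [x.1] := by
  rcases h : φ.choice [] x.1 x.2 with _ | i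
  · simp [φ.act_of_none h]
  · exact i.elim0

/-- A word is admissible if no two of its letters are compatible. -/
def Admissible (G : SimpleGraph V) (w : List V) : Prop := ∀ a ∈ w, ∀ b ∈ w, ¬ G.Adj a b

theorem Admissible.sublist {w w' : List V} (h : Admissible G w) (hs : w'.Sublist w) :
    Admissible G w' :=
  fun a ha b hb => h a (hs.subset ha) b (hs.subset hb)

theorem Admissible.act {w : List V} (hw : Admissible G w) (x : Item G) :
    Admissible G (φ.act w x) := by
  rcases h : φ.choice w x.1 x.2 with _ | i
  · rw [φ.act_of_none h]
    have key := φ.not_adj_of_none w x.1 x.2 h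
    intro a ha b hb
    simp only [List.mem_append, List.mem_singleton] at ha hb
    rcases ha with ha | rfl <;> rcases hb with hb | rfl
    · exact hw a ha b hb
    · exact fun hab => key a ha hab.symm
    · exact key b hb
    · exact G.irrefl
  · rw [φ.act_of_some h]
    exact hw.sublist (List.eraseIdx_sublist _ _)

theorem Policy.even_length_act (w : List V) (x : Item G) :
    Even (φ.act w x).length ↔ ¬ Even w.length := by
  rcases h : φ.choice w x.1 x.2 with _ | i
  · rw [φ.act_of_none h]
    simp [Nat.even_add_one]
  · rw [φ.act_of_some h, List.length_eraseIdx_of_lt i.2]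
    have := i.2
    obtain ⟨n, hn⟩ : ∃ n, w.length = n + 1 := ⟨w.length - 1, by omega⟩
    rw [hn, Nat.add_sub_cancel, Nat.even_add_one, not_not]

theorem Policy.evenStep_mem {w : List V} (hw : w ∈ EvenQueue G) (s : Item G × Item G) :
    φ.evenStep w s ∈ EvenQueue G := by
  refine ⟨Admissible.act φ (Admissible.act φ hw.1 _) _, ?_⟩
  rw [Policy.evenStep, φ.even_length_act, φ.even_length_act, not_not]
  exact hw.2

theorem nil_mem_evenQueue : ([] : List V) ∈ EvenQueue G := by
  simp [EvenQueue]

theorem Policy.foldl_evenStep_mem {w : List V} (hw : w ∈ EvenQueue G)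
    (z : List (Item G × Item G)) : z.foldl φ.evenStep w ∈ EvenQueue G := by
  induction z generalizing w with
  | nil => exact hw
  | cons s z ih => exact ih (φ.evenStep_mem hw s)

/-- The buffer content `k` time slots after time `m`, in the system that starts at time `m` with
the buffer content `w`. -/
def Policy.flow (ω : Input G) (m : ℤ) (w : List V) : ℕ → List V
  | 0 => w
  | k + 1 => φ.evenStep (Policy.flow ω m w k) (ω (m + k))

theorem Policy.flow_succ (ω : Input G) (m : ℤ) (w : List V) (k : ℕ) :
    φ.flow ω m w (k + 1) = φ.evenStep (φ.flow ω m w k) (ω (m + k)) := rfl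

theorem Policy.flow_add (ω : Input G) (m : ℤ) (w : List V) (j k : ℕ) :
    φ.flow ω m w (j + k) = φ.flow ω (m + j) (φ.flow ω m w j) k := by
  induction k with
  | zero => rfl
  | succ k ih =>
    rw [← add_assoc, Policy.flow_succ, ih, Policy.flow_succ]
    congr 2
    push_cast
    ring

theorem Policy.flow_succ' (ω : Input G) (m : ℤ) (w : List V) (k : ℕ) :
    φ.flow ω m w (k + 1) = φ.flow ω (m + 1) (φ.evenStep w (ω m)) k := by
  rw [add_comm, Policy.flow_add]
  simp [Policy.flow]

theorem Policy.flow_shift (ω : Input G) (n m : ℤ) (w : List V) (k : ℕ) :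
    φ.flow (shift n ω) m w k = φ.flow ω (m + n) w k := by
  induction k with
  | zero => rfl
  | succ k ih =>
    rw [Policy.flow_succ, ih, Policy.flow_succ, shift, add_right_comm]

theorem Policy.evenBuffer_eq_flow (Y : Input G → List V) (ω : Input G) (k : ℕ) :
    φ.evenBuffer Y ω k = φ.flow ω 0 (Y ω) k := by
  induction k with
  | zero => rfl
  | succ k ih => rw [Policy.evenBuffer, ih, Policy.flow_succ, zero_add]

theorem Policy.flow_mem (ω : Input G) (m : ℤ) {w : List V} (hw : w ∈ EvenQueue G) (k : ℕ) :
    φ.flow ω m w k ∈ EvenQueue G := by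
  induction k with
  | zero => exact hw
  | succ k ih => exact φ.evenStep_mem ih _

/-- The word `z` of pairs of items enters from time `n` on. -/
def Occurs (z : List (Item G × Item G)) (n : ℤ) (ω : Input G) : Prop :=
  ∀ i : ℕ, ∀ h : i < z.length, ω (n + i) = z[i]

theorem Policy.flow_of_occurs {z : List (Item G × Item G)} {n : ℤ} {ω : Input G}
    (h : Occurs z n ω) (w : List V) : φ.flow ω n w z.length = z.foldl φ.evenStep w := by
  induction z generalizing n w with
  | nil => rfl
  | cons s z ih =>
    have h0 : ω n = s := by
      have := h 0 (by simp)
      simp only [Nat.cast_zero, add_zero] at this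
      exact this
    rw [List.length_cons, Policy.flow_succ', List.foldl_cons, h0]
    refine ih (fun i hi => ?_) _
    have := h (i + 1) (by simpa using hi)
    simpa [add_assoc, add_comm, add_left_comm] using this

end Dynamics

/-! ### Erasing words in non-bipartite graphs -/

section ErasingWords

variable {V : Type*} {G : SimpleGraph V} (φ : Policy G)

theorem Policy.act_singleton_of_adj {a v : V} (h : G.Adj v a) (σ : PrefList G) :
    φ.act [a] (v, σ) = [] := by
  rcases hc : φ.choice [a] v σ with _ | i
  · exact absurd h (φ.not_adj_of_none _ _ _ hc a (by simp))
  · rw [φ.act_of_some (x := (v, σ)) hc]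
    fin_cases i
    rfl

theorem Policy.act_singleton_of_not_adj {a v : V} (h : ¬ G.Adj v a) (σ : PrefList G) :
    φ.act [a] (v, σ) = [a, v] := by
  rcases hc : φ.choice [a] v σ with _ | i
  · simp [φ.act_of_none (x := (v, σ)) hc]
  · have := φ.adj_of_some _ _ _ _ hc
    simp at this
    exact absurd this h

theorem Policy.act_pair {a b v : V} (h : G.Adj v a ∨ G.Adj v b) (σ : PrefList G) :
    (φ.act [a, b] (v, σ) = [b] ∧ G.Adj v a) ∨ (φ.act [a, b] (v, σ) = [a] ∧ G.Adj v b) := by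
  rcases hc : φ.choice [a, b] v σ with _ | i
  · have := φ.not_adj_of_none _ _ _ hc
    simp at this
    tauto
  · have h' := φ.adj_of_some _ _ _ _ hc
    rw [φ.act_of_some (x := (v, σ)) hc]
    fin_cases i
    · left; simpa using h'
    · right; simpa using h'

theorem Policy.evenStep_nil_of_adj {u v : V} (h : G.Adj u v) (σ : PrefList G) :
    φ.evenStep [] ((u, σ), (v, σ)) = [] := by
  rw [Policy.evenStep, φ.act_nil]
  exact φ.act_singleton_of_adj h.symm σ

theorem exists_adj_walk_of_length_succ {a b : V} {n : ℕ} (h : ∃ p : G.Walk a b, p.length = n + 1) :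
    ∃ c, G.Adj a c ∧ ∃ p : G.Walk c b, p.length = n := by
  obtain ⟨p, hp⟩ := h
  cases p with
  | nil => simp at hp
  | cons hac q => exact ⟨_, hac, q, by simpa using hp⟩

theorem exists_walk_comm {a b : V} {n : ℕ} (h : ∃ p : G.Walk a b, p.length = n) :
    ∃ p : G.Walk b a, p.length = n := by
  obtain ⟨p, hp⟩ := h
  exact ⟨p.reverse, by simpa using hp⟩

/-- All lists of preferences in the word `z` are equal to `σ`. -/
def HasPref (σ : PrefList G) (z : List (Item G × Item G)) : Prop :=
  ∀ s ∈ z, s.1.2 = σ ∧ s.2.2 = σ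

/-- The word `z` empties the buffer when it is started with the content `w`, and also when it is
started empty. -/
def Policy.Erases (z : List (Item G × Item G)) (w : List V) : Prop :=
  z.foldl φ.evenStep [] = [] ∧ z.foldl φ.evenStep w = []

/-- Two stored items whose classes are joined by a walk of odd length `2 * m + 1` can be erased by
a word that, by itself, is perfectly matched. The pairs of letters of the word are adjacent
classes on the walk. After the first pair, either nothing is left, or the two classes that remain
are the ends of a shorter odd walk: if both ends of the walk see the policy choose the opposite
stored item, then the walk can be closed up at the other end. -/
theorem Policy.exists_erases_of_odd_walk (σ : PrefList G) (m : ℕ) :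
    ∀ a b : V, ¬ G.Adj a b → (∃ p : G.Walk a b, p.length = 2 * m + 1) →
      ∃ z, HasPref σ z ∧ φ.Erases z [a, b] := by
  induction m with
  | zero =>
    intro a b hab hp
    obtain ⟨c, hac, p, hp⟩ := exists_adj_walk_of_length_succ hp
    cases p with
    | nil => exact absurd hac hab
    | cons _ _ => simp at hp
  | succ m ih =>
    intro a b hab hp
    -- after the letters `u, v`, the first of which is matched, the class `c` is left with `v`
    have key : ∀ c u v : V, G.Adj u v → φ.act [a, b] (u, σ) = [c] →
        (∃ p : G.Walk c v, p.length = 2 * m + 1) → ∃ z, HasPref σ z ∧ φ.Erases z [a, b] := by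
      intro c u v huv hact hw
      by_cases hvc : G.Adj v c
      · refine ⟨[((u, σ), (v, σ))], by simp [HasPref], ?_, ?_⟩
        · simpa using φ.evenStep_nil_of_adj huv σ
        · simpa [Policy.evenStep, hact] using φ.act_singleton_of_adj hvc σ
      · obtain ⟨z, hz, hz0, hz1⟩ := ih c v (fun h => hvc h.symm) hw
        refine ⟨((u, σ), (v, σ)) :: z, ?_, ?_, ?_⟩
        · intro s hs
          rcases List.mem_cons.1 hs with rfl | hs
          · simp
          · exact hz s hs
        · rw [List.foldl_cons, φ.evenStep_nil_of_adj huv σ, hz0]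
        · rw [List.foldl_cons, Policy.evenStep, hact, φ.act_singleton_of_not_adj hvc σ, hz1]
    obtain ⟨u₁, hau₁, hp₁⟩ := exists_adj_walk_of_length_succ (n := 2 * m + 2) hp
    obtain ⟨u₂, hu₁₂, hp₂⟩ := exists_adj_walk_of_length_succ (n := 2 * m + 1) hp₁
    obtain ⟨v₁, hbv₁, hq₁⟩ :=
      exists_adj_walk_of_length_succ (n := 2 * m) (exists_walk_comm hp₂)
    rcases φ.act_pair (a := a) (b := b) (v := u₁) (Or.inl hau₁.symm) σ with ⟨h1, -⟩ | ⟨h1, h1'⟩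
    · exact key b u₁ u₂ hu₁₂ h1 (exists_walk_comm hp₂)
    · rcases φ.act_pair (a := a) (b := b) (v := v₁) (Or.inr hbv₁.symm) σ with ⟨-, h2'⟩ | ⟨h2, -⟩
      · refine key a u₁ u₂ hu₁₂ h1 ?_
        obtain ⟨q, hq⟩ := hq₁
        exact ⟨q.cons h2'.symm, by simpa using hq⟩
      · obtain ⟨q, hq⟩ := hq₁
        obtain ⟨v₂, hv₁₂, hq₂⟩ := exists_adj_walk_of_length_succ (n := 2 * m + 1)
          ⟨(q.append (SimpleGraph.Walk.cons hu₁₂.symm (SimpleGraph.Walk.cons hau₁.symm .nil))),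
            by simp [hq]⟩
        exact key a v₁ v₂ hv₁₂ h2 (exists_walk_comm hq₂)

/-- In a connected graph that is not bipartite, any two vertices are joined by an odd walk. -/
theorem exists_odd_walk (hG : G.Connected) (h2 : ¬ G.Colorable 2) (a b : V) :
    ∃ m : ℕ, ∃ p : G.Walk a b, p.length = 2 * m + 1 := by
  rw [SimpleGraph.two_colorable_iff_forall_loop_even] at h2
  push Not at h2
  obtain ⟨u, c, hc⟩ := h2
  obtain ⟨p⟩ := hG.preconnected a u
  obtain ⟨q⟩ := hG.preconnected u b
  have hodd : Odd c.length := by simpa using hc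
  rcases Nat.even_or_odd (p.length + q.length) with h | h
  · have : Odd ((p.append c).append q).length := by
      simp only [SimpleGraph.Walk.length_append]
      have := h.add_odd hodd
      convert this using 1
      ring
    obtain ⟨m, hm⟩ := this
    exact ⟨m, _, hm⟩
  · have : Odd (p.append q).length := by simpa using h
    obtain ⟨m, hm⟩ := this
    exact ⟨m, _, hm⟩

theorem Policy.foldl_act_of_admissible (σ : PrefList G) (w u : List V)
    (h : Admissible G (u ++ w)) :
    (w.map fun v => (v, σ)).foldl φ.act u = u ++ w := by
  induction w generalizing u with
  | nil => simp
  | cons v w ih =>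
    have hv : φ.act u (v, σ) = u ++ [v] := by
      rcases hc : φ.choice u v σ with _ | i
      · exact φ.act_of_none (x := (v, σ)) hc
      · exact absurd (φ.adj_of_some _ _ _ _ hc)
          (h v (by simp) _ (List.mem_append_left _ (List.get_mem _ _)))
    rw [List.map_cons, List.foldl_cons, hv, ih _ (by simpa using h)]
    simp

theorem Policy.foldl_evenStep_eq (w : List V) (z : List (Item G × Item G)) :
    z.foldl φ.evenStep w = (z.flatMap fun s => [s.1, s.2]).foldl φ.act w := by
  induction z generalizing w with
  | nil => rfl
  | cons s z ih => simp [ih, Policy.evenStep]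

/-- Sub-additivity, for a system that is started with an admissible content `w ++ w'` and fed with
a word `z`. -/
theorem Policy.SubAdditive.length_foldl_le {φ : Policy G} (hφ : φ.SubAdditive) {σ : PrefList G}
    (hσ : σ ∈ φ.prefLaw.support) {w w' : List V} (hw : Admissible G (w ++ w'))
    {z : List (Item G × Item G)} (hz : HasPref σ z) :
    (z.foldl φ.evenStep (w ++ w')).length ≤ w.length + (z.foldl φ.evenStep w').length := by
  have h := hφ (w.map fun v => (v, σ))
    ((w'.map fun v => (v, σ)) ++ z.flatMap fun s => [s.1, s.2]) ?_ ?_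
  · have hw1 : Admissible G w := hw.sublist (List.sublist_append_left _ _)
    have hw2 : Admissible G w' := hw.sublist (List.sublist_append_right _ _)
    simp only [Policy.queue, List.foldl_append] at h
    rw [φ.foldl_act_of_admissible σ w [] hw1, φ.foldl_act_of_admissible σ w' [] hw2] at h
    simp only [List.nil_append] at h
    rw [φ.foldl_act_of_admissible σ w' w hw] at h
    simpa only [φ.foldl_evenStep_eq] using h
  · intro x hx
    obtain ⟨v, -, rfl⟩ := List.mem_map.1 hx
    exact hσ
  · intro x hx
    rcases List.mem_append.1 hx with hx | hx
    · obtain ⟨v, -, rfl⟩ := List.mem_map.1 hx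
      exact hσ
    · obtain ⟨s, hs, hx⟩ := List.mem_flatMap.1 hx
      have := hz s hs
      rcases List.mem_cons.1 hx with rfl | hx
      · rw [this.1]; exact hσ
      · rw [List.mem_singleton.1 hx, this.2]; exact hσ

theorem HasPref.append {σ : PrefList G} {z z' : List (Item G × Item G)} (h : HasPref σ z)
    (h' : HasPref σ z') : HasPref σ (z ++ z') := by
  intro s hs
  rcases List.mem_append.1 hs with hs | hs
  · exact h s hs
  · exact h' s hs

/-- One word erases all the admissible words of length two: erase them one after the other, using
that by sub-additivity the buffer started with a word of length two never has more than two items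
at the end of a perfectly matched word. -/
theorem Policy.exists_erases_pairs (hG : G.Connected) (h2 : ¬ G.Colorable 2)
    (hφ : φ.SubAdditive) {σ : PrefList G} (hσ : σ ∈ φ.prefLaw.support) (l : List (V × V)) :
    ∃ z, HasPref σ z ∧ z.foldl φ.evenStep [] = [] ∧
      ∀ p ∈ l, ¬ G.Adj p.1 p.2 → z.foldl φ.evenStep [p.1, p.2] = [] := by
  induction l with
  | nil => exact ⟨[], by simp [HasPref], rfl, by simp⟩
  | cons q l ih =>
    obtain ⟨z, hz, hz0, hz1⟩ := ih
    by_cases hq : G.Adj q.1 q.2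
    · refine ⟨z, hz, hz0, fun p hp hpa => ?_⟩
      rcases List.mem_cons.1 hp with rfl | hp
      · exact absurd hq hpa
      · exact hz1 p hp hpa
    · have hadm : Admissible G [q.1, q.2] := by
        intro a ha b hb
        simp only [List.mem_cons, List.not_mem_nil, or_false] at ha hb
        rcases ha with rfl | rfl <;> rcases hb with rfl | rfl
        · exact G.irrefl
        · exact hq
        · exact fun h => hq h.symm
        · exact G.irrefl
      have hmem : z.foldl φ.evenStep [q.1, q.2] ∈ EvenQueue G :=
        φ.foldl_evenStep_mem ⟨hadm, by simp⟩ z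
      have hlen : (z.foldl φ.evenStep [q.1, q.2]).length ≤ 2 := by
        simpa [hz0] using hφ.length_foldl_le hσ (w := [q.1, q.2]) (w' := []) (by simpa using hadm) hz
      obtain ⟨z', hz', hz0', hz1'⟩ : ∃ z', HasPref σ z' ∧
          φ.Erases z' (z.foldl φ.evenStep [q.1, q.2]) := by
        generalize z.foldl φ.evenStep [q.1, q.2] = w at hmem hlen
        match w, hlen, hmem with
        | [], _, _ => exact ⟨[], by simp [HasPref], rfl, rfl⟩
        | [a], _, h => exact absurd h.2 (by simp)
        | [a, b], _, h =>
          obtain ⟨m, hm⟩ := exists_odd_walk hG h2 a b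
          exact φ.exists_erases_of_odd_walk σ m a b (h.1 a (by simp) b (by simp)) hm
      refine ⟨z ++ z', hz.append hz', by rw [List.foldl_append, hz0, hz0'], fun p hp hpa => ?_⟩
      rcases List.mem_cons.1 hp with rfl | hp
      · rw [List.foldl_append, hz1']
      · rw [List.foldl_append, hz1 p hp hpa, hz0']

/-- For every `r`, some word empties the buffer from every content of length at most `2 * r`. -/
theorem Policy.exists_erases [Finite V] (hG : G.Connected) (h2 : ¬ G.Colorable 2)
    (hφ : φ.SubAdditive) {σ : PrefList G} (hσ : σ ∈ φ.prefLaw.support) (r : ℕ) :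
    ∃ z, HasPref σ z ∧ ∀ w ∈ EvenQueue G, w.length ≤ 2 * r → z.foldl φ.evenStep w = [] := by
  have := Fintype.ofFinite V
  obtain ⟨z, hz, hz0, hz1⟩ :=
    φ.exists_erases_pairs hG h2 hφ hσ (Finset.univ : Finset (V × V)).toList
  induction r with
  | zero =>
    refine ⟨[], by simp [HasPref], fun w _ hw => ?_⟩
    simpa using hw
  | succ r ih =>
    obtain ⟨z', hz', hr⟩ := ih
    refine ⟨z ++ z', hz.append hz', fun w hw hlen => ?_⟩
    rw [List.foldl_append]
    refine hr _ (φ.foldl_evenStep_mem hw z) ?_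
    by_cases h : w.length ≤ 1
    · have hnil : w = [] := by
        have := hw.2
        rcases w with _ | ⟨a, _ | ⟨b, w⟩⟩
        · rfl
        · simp at this
        · simp at h
      rw [hnil, hz0]
      simp
    · -- the last two letters of `w` are erased
      obtain ⟨w', a, b, rfl⟩ : ∃ w' a b, w = w' ++ [a, b] := by
        refine ⟨w.take (w.length - 2), w[w.length - 2], w[w.length - 1], ?_⟩
        conv_lhs => rw [← List.take_append_drop (w.length - 2) w]
        congr 1
        rw [List.drop_eq_getElem_cons (by omega), List.drop_eq_getElem_cons (by omega),
          List.drop_of_length_le (by omega)]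
        congr 3
        omega
      have := hφ.length_foldl_le hσ hw.1 hz
      rw [hz1 (a, b) (by simp) (hw.1 a (by simp) b (by simp))] at this
      simp only [List.length_append, List.length_cons, List.length_nil] at hlen this
      omega

end ErasingWords

/-! ### The color difference in bipartite graphs -/

section TwoColorings

variable {V : Type*} {G : SimpleGraph V} (φ : Policy G)

/-- The difference between the numbers of letters of the two colors in a word. -/
def colorDiff (c : G.Coloring (Fin 2)) (w : List V) : ℤ :=
  (w.map fun v => if c v = 0 then (1 : ℤ) else -1).sum

theorem abs_colorDiff_le (c : G.Coloring (Fin 2)) (w : List V) : |colorDiff c w| ≤ w.length := by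
  induction w with
  | nil => simp [colorDiff]
  | cons v w ih =>
    have : colorDiff c (v :: w) = (if c v = 0 then (1 : ℤ) else -1) + colorDiff c w := by
      simp [colorDiff]
    rw [this]
    refine (abs_add_le _ _).trans ?_
    have : |(if c v = 0 then (1 : ℤ) else -1)| = 1 := by split_ifs <;> simp
    rw [this]
    rw [List.length_cons]
    push_cast
    linarith

/-- In a bipartite graph, an arrival moves the difference of the numbers of stored items of the two
colors by an amount that depends on the class of the arriving item only. -/
theorem Policy.colorDiff_act (c : G.Coloring (Fin 2)) (w : List V) (x : Item G) :
    colorDiff c (φ.act w x) = colorDiff c w + (if c x.1 = 0 then (1 : ℤ) else -1) := by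
  rcases h : φ.choice w x.1 x.2 with _ | i
  · rw [φ.act_of_none h]
    simp [colorDiff]
  · rw [φ.act_of_some h]
    have hadj := c.valid (φ.adj_of_some _ _ _ _ h)
    have hsum : colorDiff c w = colorDiff c (w.eraseIdx i)
        + (if c (w.get i) = 0 then (1 : ℤ) else -1) := by
      unfold colorDiff
      rw [← List.eraseIdx_map, add_comm]
      have := List.getElem_cons_eraseIdx_perm
        (l := w.map fun v => if c v = 0 then (1 : ℤ) else -1) (n := i) (by simp)
      rw [← this.sum_eq]
      simp
    rw [hsum]
    have : ∀ p q : Fin 2, p ≠ q →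
        (if q = 0 then (1 : ℤ) else -1) + (if p = 0 then (1 : ℤ) else -1) = 0 := by decide
    linarith [this _ _ hadj]

theorem Policy.colorDiff_foldl_replicate (c : G.Coloring (Fin 2)) (w : List V) (a : V)
    (σ : PrefList G) (r : ℕ) :
    colorDiff c ((List.replicate r ((a, σ), (a, σ))).foldl φ.evenStep w)
      = colorDiff c w + 2 * r * (if c a = 0 then (1 : ℤ) else -1) := by
  induction r generalizing w with
  | zero => simp
  | succ r ih =>
    rw [List.replicate_succ, List.foldl_cons, ih, Policy.evenStep, φ.colorDiff_act,
      φ.colorDiff_act]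
    push_cast
    ring

/-- In a bipartite graph, the effect of an input on the color difference does not depend on the
initial content. -/
theorem Policy.colorDiff_flow (c : G.Coloring (Fin 2)) (ω : Input G) (m : ℤ) (w w' : List V)
    (k : ℕ) : colorDiff c (φ.flow ω m w k) - colorDiff c w
      = colorDiff c (φ.flow ω m w' k) - colorDiff c w' := by
  induction k with
  | zero => simp [Policy.flow]
  | succ k ih =>
    simp only [Policy.flow_succ, Policy.evenStep, φ.colorDiff_act]
    linarith

end TwoColorings


/-! ### The law of the input: stationarity, independence, recurrence -/

section Law

variable {V : Type*} {G : SimpleGraph V}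

instance : DiscreteMeasurableSpace (PrefList G) := ⟨fun _ => trivial⟩

instance [Finite V] : Finite (PrefList G) :=
  inferInstanceAs (Finite ((v : V) → Equiv.Perm (G.neighborSet v)))

theorem shift_shift (m n : ℤ) (ω : Input G) : shift m (shift n ω) = shift (m + n) ω := by
  funext k
  simp [shift, add_assoc]

theorem shift_zero (ω : Input G) : shift 0 ω = ω := by
  funext k
  simp [shift]

theorem shift_iterate (n : ℤ) (k : ℕ) (ω : Input G) : (shift n)^[k] ω = shift (k * n) ω := by
  induction k with
  | zero => simp [shift_zero]
  | succ k ih =>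
    rw [Function.iterate_succ_apply', ih, shift_shift]
    congr 1
    push_cast
    ring

theorem occurs_shift {z : List (Item G × Item G)} {m n : ℤ} {ω : Input G} :
    Occurs z m (shift n ω) ↔ Occurs z (m + n) ω := by
  simp only [Occurs, shift, add_right_comm]

variable [MeasurableSpace V]

theorem measurable_shift (n : ℤ) : Measurable (shift n : Input G → Input G) :=
  measurable_pi_lambda _ fun k => measurable_pi_apply (k + n)

variable (μ : PMF V) (φ : Policy G)

instance : IsProbabilityMeasure (inputLaw μ φ) := by
  unfold inputLaw; infer_instance

theorem measurePreserving_shift (n : ℤ) :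
    MeasurePreserving (shift n) (inputLaw μ φ) (inputLaw μ φ) := by
  refine ⟨measurable_shift n, ?_⟩
  refine Measure.eq_infinitePi _ fun s t ht => ?_
  have hpre : shift n ⁻¹' (Set.pi s t)
      = Set.pi (s.map (Equiv.addRight n).toEmbedding : Finset ℤ)
        (fun i => t (i - n) : ℤ → Set (Item G × Item G)) := by
    ext ω
    simp only [Set.mem_preimage, Set.mem_pi, Finset.coe_map, Set.forall_mem_image]
    simp [shift]
  rw [Measure.map_apply (measurable_shift n)
    (MeasurableSet.pi s.countable_toSet fun i _ => ht i), hpre, inputLaw,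
    Measure.infinitePi_pi _ (fun i _ => ht _), Finset.prod_map]
  simp

variable {μ φ}

theorem ae_forall_shift {p : Input G → Prop} (h : ∀ᵐ ω ∂(inputLaw μ φ), p ω) :
    ∀ᵐ ω ∂(inputLaw μ φ), ∀ n : ℤ, p (shift n ω) :=
  ae_all_iff.2 fun n => (measurePreserving_shift μ φ n).quasiMeasurePreserving.ae h

/-- Poincaré recurrence, in both directions of time. -/
theorem ae_frequently_shift_mem {s : Set (Input G)} (hs : MeasurableSet s) (e : ℤ) :
    ∀ᵐ ω ∂(inputLaw μ φ), ω ∈ s → ∃ᶠ k : ℕ in atTop, shift (k * e) ω ∈ s := by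
  have := (measurePreserving_shift μ φ e).conservative.ae_mem_imp_frequently_image_mem
    hs.nullMeasurableSet
  simpa only [shift_iterate] using this

/-- The sigma-algebra generated by the items that enter at the times in `T`. -/
abbrev inputSigma (T : Set ℤ) : MeasurableSpace (Input G) :=
  ⨆ i ∈ T, MeasurableSpace.comap (fun ω : Input G => ω i) inferInstance

theorem measurable_eval_inputSigma {T : Set ℤ} {i : ℤ} (hi : i ∈ T) :
    Measurable[inputSigma T] (fun ω : Input G => ω i) := by
  rw [measurable_iff_comap_le]
  exact le_iSup₂_of_le (f := fun i (_ : i ∈ T) =>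
    MeasurableSpace.comap (fun ω : Input G => ω i) inferInstance) i hi le_rfl

theorem inputSigma_mono {S T : Set ℤ} (h : S ⊆ T) :
    (inputSigma S : MeasurableSpace (Input G)) ≤ inputSigma T :=
  iSup₂_le fun _ hi => measurable_iff_comap_le.1 (measurable_eval_inputSigma (h hi))

theorem inputSigma_le (T : Set ℤ) :
    (inputSigma T : MeasurableSpace (Input G)) ≤ MeasurableSpace.pi :=
  iSup₂_le fun i _ => measurable_iff_comap_le.1 (measurable_pi_apply i)

theorem measurable_shift_inputSigma {S T : Set ℤ} (n : ℤ) (h : ∀ i ∈ S, i + n ∈ T) :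
    Measurable[inputSigma T, inputSigma S] (shift n : Input G → Input G) := by
  rw [measurable_iff_comap_le, inputSigma, MeasurableSpace.comap_iSup]
  refine iSup_le fun i => ?_
  rw [MeasurableSpace.comap_iSup]
  refine iSup_le fun hi => ?_
  rw [MeasurableSpace.comap_comp]
  exact measurable_iff_comap_le.1 (measurable_eval_inputSigma (h i hi))

variable (μ φ)

theorem iIndep_inputLaw : ProbabilityTheory.iIndep
    (fun i : ℤ => MeasurableSpace.comap (fun ω : Input G => ω i) inferInstance)
    (inputLaw μ φ) := by
  rw [← ProbabilityTheory.iIndepFun_iff_iIndep (f := fun (i : ℤ) (ω : Input G) => ω i)]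
  unfold inputLaw
  exact ProbabilityTheory.iIndepFun_infinitePi (X := fun _ => id) (fun _ => measurable_id)

theorem indep_inputSigma {S T : Set ℤ} (h : Disjoint S T) :
    ProbabilityTheory.Indep (inputSigma S) (inputSigma T) (inputLaw μ φ) :=
  ProbabilityTheory.indep_iSup_of_disjoint
    (fun i => measurable_iff_comap_le.1 (measurable_pi_apply i)) (iIndep_inputLaw μ φ) h

variable [Finite V] [DiscreteMeasurableSpace V]

theorem measurableSet_occurs (z : List (Item G × Item G)) (n : ℤ) {T : Set ℤ}
    (hT : ∀ i < z.length, n + i ∈ T) : MeasurableSet[inputSigma T] {ω | Occurs z n ω} := by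
  have : {ω : Input G | Occurs z n ω}
      = ⋂ (i : ℕ) (h : i < z.length), (fun ω : Input G => ω (n + i)) ⁻¹' {z[i]} := by
    ext ω; simp [Occurs]
  rw [this]
  exact MeasurableSet.iInter fun i => MeasurableSet.iInter fun h =>
    measurable_eval_inputSigma (hT i h) (MeasurableSet.singleton _)

theorem inputLaw_occurs_ne_zero (hμ : ∀ v : V, v ∈ μ.support) {z : List (Item G × Item G)}
    (hz : ∀ s ∈ z, s.1.2 ∈ φ.prefLaw.support ∧ s.2.2 ∈ φ.prefLaw.support) :
    inputLaw μ φ {ω | Occurs z 0 ω} ≠ 0 := by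
  have hpre : {ω : Input G | Occurs z 0 ω}
      = Set.pi ((Finset.range z.length).map (Nat.castEmbedding (R := ℤ)) : Finset ℤ)
        (fun i => {s | ∀ h : i.toNat < z.length, s = z[i.toNat]} :
          ℤ → Set (Item G × Item G)) := by
    ext ω
    simp +contextual [Occurs, Set.mem_pi]
  rw [hpre, inputLaw, Measure.infinitePi_pi _ (fun i _ => MeasurableSet.of_discrete),
    Finset.prod_map, Finset.prod_ne_zero_iff]
  intro i hi
  have hi : i < z.length := by simpa using hi
  have : {s | ∀ h : (Nat.castEmbedding (R := ℤ) i).toNat < z.length,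
      s = z[(Nat.castEmbedding (R := ℤ) i).toNat]}
      = ({z[i].1.1} ×ˢ {z[i].1.2}) ×ˢ ({z[i].2.1} ×ˢ {z[i].2.2}) := by
    ext ⟨⟨a, b⟩, ⟨c, d⟩⟩
    simp [hi, Prod.ext_iff, and_assoc]
  rw [this, Measure.prod_prod, Measure.prod_prod, Measure.prod_prod]
  simp only [PMF.toMeasure_apply_singleton _ _ (MeasurableSet.singleton _)]
  have h := hz z[i] (List.getElem_mem hi)
  simp only [ne_eq, mul_eq_zero, not_or]
  exact ⟨⟨(PMF.mem_support_iff _ _).1 (hμ _), (PMF.mem_support_iff _ _).1 h.1⟩,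
    (PMF.mem_support_iff _ _).1 (hμ _), (PMF.mem_support_iff _ _).1 h.2⟩

variable {μ φ}

/-- If an event `A` of the past has positive probability and if `z` is a word with positive
probability, then almost surely, at arbitrarily remote past times `n`, the event `A` holds at time
`n` and the word `z` enters from time `n` on. By independence the two happen together with positive
probability, the same for every `n`; and by Kolmogorov's zero-one law, that they happen for
infinitely many `n < 0` has probability zero or one. -/
theorem ae_exists_le_shift_mem_and_occurs (hμ : ∀ v : V, v ∈ μ.support) {A : Set (Input G)}
    (hA : MeasurableSet[inputSigma (Set.Iio 0)] A) (hA0 : inputLaw μ φ A ≠ 0)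
    {z : List (Item G × Item G)}
    (hz : ∀ s ∈ z, s.1.2 ∈ φ.prefLaw.support ∧ s.2.2 ∈ φ.prefLaw.support) :
    ∀ᵐ ω ∂(inputLaw μ φ), ∀ m : ℤ, ∃ n ≤ m, shift n ω ∈ A ∧ Occurs z n ω := by
  have hE0 : inputLaw μ φ (A ∩ {ω | Occurs z 0 ω}) ≠ 0 := by
    have hdisj : Disjoint (Set.Iio (0 : ℤ)) (Set.Ici 0) := by
      rw [Set.disjoint_left]; intro i; simp
    rw [((indep_inputSigma μ φ hdisj).indepSet_of_measurableSet hA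
      (measurableSet_occurs z 0 (by simp))).measure_inter_eq_mul]
    exact mul_ne_zero hA0 (inputLaw_occurs_ne_zero μ φ hμ hz)
  set E : ℤ → Set (Input G) := fun n => shift n ⁻¹' (A ∩ {ω | Occurs z 0 ω}) with hE
  have hEmeas : ∀ n a : ℤ, n + z.length ≤ a → MeasurableSet[inputSigma (Set.Iio a)] (E n) := by
    intro n a hna
    refine measurable_shift_inputSigma (S := Set.Iio (z.length : ℤ)) n ?_ ?_
    · intro i hi
      simp only [Set.mem_Iio] at hi ⊢
      omega
    · refine MeasurableSet.inter (inputSigma_mono ?_ _ hA) (measurableSet_occurs z 0 ?_)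
      · intro i hi
        simp only [Set.mem_Iio] at hi ⊢
        omega
      · intro i hi
        simp only [Set.mem_Iio]
        omega
  have hEmeas' : ∀ n, MeasurableSet (E n) := fun n =>
    inputSigma_le _ _ (hEmeas n _ le_rfl)
  have hEm : ∀ n, inputLaw μ φ (E n) = inputLaw μ φ (A ∩ {ω | Occurs z 0 ω}) := fun n =>
    (measurePreserving_shift μ φ n).measure_preimage
      (((inputSigma_le _ _ hA).inter
        (inputSigma_le _ _ (measurableSet_occurs z 0 (T := Set.univ) (by simp)))).nullMeasurableSet)
  set F : ℤ → ℕ → Set (Input G) := fun a j => ⋃ (n : ℤ) (_ : n ≤ a - j), E n with hF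
  set T : Set (Input G) := {ω | ∀ m : ℤ, ∃ n ≤ m, ω ∈ E n} with hT
  have hTF : ∀ a : ℤ, T = ⋂ j : ℕ, F a j := by
    intro a
    ext ω
    simp only [hT, hF, Set.mem_ofPred_eq, Set.mem_iInter, Set.mem_iUnion, exists_prop]
    refine ⟨fun h j => h _, fun h m => ?_⟩
    obtain ⟨n, hn, hω⟩ := h (a - m).toNat
    exact ⟨n, by omega, hω⟩
  have htail : MeasurableSet[limsup (fun i : ℤ =>
      MeasurableSpace.comap (fun ω : Input G => ω i) inferInstance) atBot] T := by
    rw [limsup_eq_iInf_iSup]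
    rw [MeasurableSpace.measurableSet_iInf]
    intro S
    rw [MeasurableSpace.measurableSet_iInf]
    intro hS
    obtain ⟨a, ha⟩ := mem_atBot_sets.1 hS
    have hle : (inputSigma (Set.Iio (a + 1)) : MeasurableSpace (Input G)) ≤ ⨆ i ∈ S,
        MeasurableSpace.comap (fun ω : Input G => ω i) inferInstance :=
      inputSigma_mono (G := G) (T := S) fun i hi => ha i (by simpa [Int.lt_add_one_iff] using hi)
    refine hle _ ?_
    rw [hTF (a - z.length)]
    exact MeasurableSet.iInter fun j => MeasurableSet.iUnion fun n => MeasurableSet.iUnion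
      fun hn => hEmeas n _ (by omega)
  have hTm : inputLaw μ φ T ≠ 0 := by
    have hFmeas : ∀ j, MeasurableSet (F 0 j) := fun j =>
      MeasurableSet.iUnion fun n => MeasurableSet.iUnion fun _ => hEmeas' n
    have hlim := tendsto_measure_iInter_atTop (μ := inputLaw μ φ) (s := F 0)
      (fun j => (hFmeas j).nullMeasurableSet)
      (fun i j hij => Set.iUnion_subset fun n => Set.iUnion_subset fun hn =>
        Set.subset_iUnion₂_of_subset n (by omega) subset_rfl) ⟨0, measure_ne_top _ _⟩
    rw [← hTF] at hlim
    refine fun h0 => hE0 (le_antisymm ?_ zero_le)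
    rw [← h0]
    refine ge_of_tendsto hlim (Eventually.of_forall fun j => ?_)
    simp only [Function.comp_def]
    rw [← hEm (-j)]
    exact measure_mono (Set.subset_iUnion₂_of_subset (-(j : ℤ)) (by omega) subset_rfl)
  have hT1 : inputLaw μ φ T = 1 :=
    (ProbabilityTheory.measure_zero_or_one_of_measurableSet_limsup_atBot
      (fun i => measurable_iff_comap_le.1 (measurable_pi_apply i)) (iIndep_inputLaw μ φ)
      htail).resolve_left hTm
  have hTmeas : MeasurableSet T := by
    rw [hTF 0]
    exact MeasurableSet.iInter fun j => MeasurableSet.iUnion fun n => MeasurableSet.iUnion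
      fun _ => hEmeas' n
  filter_upwards [(mem_ae_iff_prob_eq_one hTmeas).2 hT1] with ω hω m
  obtain ⟨n, hn, h⟩ := hω m
  refine ⟨n, hn, h.1, ?_⟩
  simpa [occurs_shift] using h.2

/-- The buffer content is measurable with respect to the initial content and to the items that
enter. -/
theorem measurableSet_flow (φ : Policy G) (𝓜 : MeasurableSpace (Input G)) {W : Input G → List V}
    (hW : ∀ w, MeasurableSet[𝓜] {ω | W ω = w}) (m : ℤ) (k : ℕ)
    (h : ∀ i < k, Measurable[𝓜] (fun ω : Input G => ω (m + i))) (S : Set (List V)) :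
    MeasurableSet[𝓜] {ω | φ.flow ω m (W ω) k ∈ S} := by
  induction k generalizing S with
  | zero =>
    have : {ω | φ.flow ω m (W ω) 0 ∈ S} = ⋃ w ∈ S, {ω | W ω = w} := by
      ext ω; simp [Policy.flow]
    rw [this]
    exact MeasurableSet.biUnion (Set.to_countable S) fun w _ => hW w
  | succ k ih =>
    have : {ω | φ.flow ω m (W ω) (k + 1) ∈ S} = ⋃ w : List V,
        {ω | φ.flow ω m (W ω) k ∈ ({w} : Set (List V))} ∩
          (fun ω : Input G => ω (m + k)) ⁻¹' {s | φ.evenStep w s ∈ S} := by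
      ext ω; simp [Policy.flow_succ]
    rw [this]
    exact MeasurableSet.iUnion fun w => (ih (fun i hi => h i (by omega)) _).inter
      (h k (by omega) MeasurableSet.of_discrete)

/-- Under condition (H1) for `Y`, for every time `j`, all but finitely many of the systems that
start at time `-k` with the content `Y ∘ θ^{-k}` are empty again at some time up to `j`: the sum
over `k` of the probabilities of the opposite event is finite because so is the mean of `τ₁(Y)`. -/
theorem Policy.H1.ae_eventually_empty {Y : Input G → List V} (hY : IsQueueRV Y)
    (h : φ.H1 μ Y) : ∀ᵐ ω ∂(inputLaw μ φ), ∀ j : ℤ, ∀ᶠ k : ℕ in atTop,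
      ∃ i : ℕ, 0 < i ∧ -(k : ℤ) + i ≤ j ∧
        φ.flow ω (-k) (Y (shift (-k) ω)) i = [] := by
  set B : ℕ → Set (Input G) := fun k => {ω | ∀ i, 0 < i → i ≤ k → φ.evenBuffer Y ω i ≠ []} with hB
  have hBmeas : ∀ k, MeasurableSet (B k) := by
    intro k
    have : B k = ⋂ (i : ℕ) (_ : 0 < i) (_ : i ≤ k), {ω | φ.flow ω 0 (Y ω) i ∈ ({[]}ᶜ : Set _)} := by
      ext ω; simp [hB, φ.evenBuffer_eq_flow]
    rw [this]
    exact MeasurableSet.iInter fun i => MeasurableSet.iInter fun _ => MeasurableSet.iInter fun _ =>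
      measurableSet_flow φ _ hY.1 0 i (fun _ _ => measurable_pi_apply _) _
  have hsum : ∑' k, inputLaw μ φ (B k) < ⊤ := by
    refine lt_of_le_of_lt ?_ h
    have : ∀ k, inputLaw μ φ (B k) = ∫⁻ ω, (B k).indicator 1 ω ∂(inputLaw μ φ) := fun k => by
      rw [lintegral_indicator_one (hBmeas k)]
    simp only [this]
    rw [← lintegral_tsum fun k => (measurable_one.indicator (hBmeas k)).aemeasurable]
    refine lintegral_mono fun ω => le_iInf₂ fun n hn => ?_
    rw [tsum_eq_sum (s := Finset.range n)]
    · calc ∑ k ∈ Finset.range n, (B k).indicator (1 : Input G → ℝ≥0∞) ω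
          ≤ ∑ k ∈ Finset.range n, 1 :=
            Finset.sum_le_sum fun k _ => Set.indicator_le_self' (by simp) ω
        _ = n := by simp
    · intro k hk
      refine Set.indicator_of_notMem (fun hω => ?_) _
      exact hω n hn.1 (by simpa using hk) hn.2
  have key : ∀ J : ℕ, ∀ᵐ ω ∂(inputLaw μ φ), ∀ᶠ k : ℕ in atTop, shift (-(k + J : ℕ)) ω ∉ B k := by
    intro J
    refine ae_eventually_notMem (s := fun k : ℕ => shift (-(k + J : ℕ)) ⁻¹' B k) ?_
    have : ∀ k : ℕ, inputLaw μ φ (shift (-(k + J : ℕ)) ⁻¹' B k) = inputLaw μ φ (B k) := fun k =>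
      (measurePreserving_shift μ φ _).measure_preimage (hBmeas k).nullMeasurableSet
    simp only [this]
    exact hsum.ne
  filter_upwards [ae_all_iff.2 key] with ω hω j
  obtain ⟨N, hN⟩ := eventually_atTop.1 (hω (-j).toNat)
  refine eventually_atTop.2 ⟨N + (-j).toNat, fun k hk => ?_⟩
  have := hN (k - (-j).toNat) (by omega)
  rw [Nat.sub_add_cancel (by omega)] at this
  simp only [hB, Set.mem_ofPred_eq, not_forall, not_not] at this
  obtain ⟨i, hi0, hi, hi'⟩ := this
  refine ⟨i, hi0, by omega, ?_⟩
  rwa [φ.evenBuffer_eq_flow, φ.flow_shift, zero_add] at hi'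

end Law


/-! ### Systems started empty in a remote past -/

section PastLimit

variable {V : Type*} {G : SimpleGraph V} (φ : Policy G)

/-- The buffer content at time `n` is equal to `w` in all the systems that are started empty
sufficiently long before time `n`. -/
def Policy.PastLimit (ω : Input G) (n : ℤ) (w : List V) : Prop :=
  ∀ᶠ k : ℕ in atTop, φ.flow ω (n - k) [] k = w

variable {φ}

theorem Policy.PastLimit.unique {ω : Input G} {n : ℤ} {w w' : List V} (h : φ.PastLimit ω n w)
    (h' : φ.PastLimit ω n w') : w = w' := by
  obtain ⟨k, hk, hk'⟩ := (h.and h').exists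
  exact hk.symm.trans hk'

theorem Policy.PastLimit.flow {ω : Input G} {n : ℤ} {w : List V} (h : φ.PastLimit ω n w) (j : ℕ) :
    φ.PastLimit ω (n + j) (φ.flow ω n w j) := by
  obtain ⟨N, hN⟩ := eventually_atTop.1 h
  refine eventually_atTop.2 ⟨N + j, fun k hk => ?_⟩
  obtain ⟨i, rfl⟩ : ∃ i, k = i + j := ⟨k - j, by omega⟩
  rw [φ.flow_add, show n + j - ((i + j : ℕ) : ℤ) = n - i by push_cast; ring, hN i (by omega)]
  congr 1
  ring

theorem Policy.PastLimit.mem {ω : Input G} {n : ℤ} {w : List V} (h : φ.PastLimit ω n w) :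
    w ∈ EvenQueue G := by
  obtain ⟨k, rfl⟩ := h.exists
  exact φ.flow_mem _ _ nil_mem_evenQueue _

theorem Policy.pastLimit_shift {ω : Input G} {m n : ℤ} {w : List V} :
    φ.PastLimit (shift m ω) n w ↔ φ.PastLimit ω (n + m) w := by
  simp only [Policy.PastLimit, φ.flow_shift, sub_add_eq_add_sub]

variable (φ)

open Classical in
/-- The common buffer content at time `0` of the systems that are started empty sufficiently long
ago (and the empty buffer on the negligible set where there is no such common content). -/
noncomputable def Policy.limitBuffer (ω : Input G) : List V :=
  if h : ∃ w, φ.PastLimit ω 0 w then h.choose else []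

/-- The almost sure properties of the input on which the construction rests: there are arbitrarily
remote times, in the past and in the future, at which the systems started empty long ago are empty;
and every initial content, if it is put far enough in the past, leads to the empty buffer before
any given time. -/
structure Policy.IsGoodInput (ω : Input G) : Prop where
  exists_lt : ∀ m : ℤ, ∃ n < m, φ.PastLimit ω n []
  exists_gt : ∀ m : ℤ, ∃ n > m, φ.PastLimit ω n []
  eventually_empty : ∀ w ∈ EvenQueue G, ∀ j : ℤ, ∀ᶠ k : ℕ in atTop,
    ∃ i : ℕ, 0 < i ∧ -(k : ℤ) + i ≤ j ∧ φ.flow ω (-k) w i = []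

variable {φ}

theorem Policy.IsGoodInput.exists_pastLimit {ω : Input G} (h : φ.IsGoodInput ω) (n : ℤ) :
    ∃ w, φ.PastLimit ω n w := by
  obtain ⟨c, hc, hc'⟩ := h.exists_lt n
  have := hc'.flow (n - c).toNat
  rw [Int.toNat_of_nonneg (by omega), add_sub_cancel] at this
  exact ⟨_, this⟩

theorem Policy.limitBuffer_eq_of_pastLimit {ω : Input G} {w : List V} (h : φ.PastLimit ω 0 w) :
    φ.limitBuffer ω = w := by
  have hex : ∃ w, φ.PastLimit ω 0 w := ⟨w, h⟩
  rw [Policy.limitBuffer, dif_pos hex]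
  exact hex.choose_spec.unique h

theorem Policy.IsGoodInput.pastLimit_limitBuffer {ω : Input G} (h : φ.IsGoodInput ω) (n : ℤ) :
    φ.PastLimit ω n (φ.limitBuffer (shift n ω)) := by
  obtain ⟨w, hw⟩ := h.exists_pastLimit n
  have : φ.PastLimit (shift n ω) 0 w := by rwa [Policy.pastLimit_shift, zero_add]
  rwa [Policy.limitBuffer_eq_of_pastLimit this]

theorem Policy.IsGoodInput.mem_constructionPoints {ω : Input G} (h : φ.IsGoodInput ω) {n : ℤ} :
    n ∈ constructionPoints φ.limitBuffer ω ↔ φ.PastLimit ω n [] := by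
  refine ⟨fun hn => ?_, fun hn => ?_⟩
  · have := h.pastLimit_limitBuffer n
    rwa [show φ.limitBuffer (shift n ω) = [] from hn] at this
  · exact (h.pastLimit_limitBuffer n).unique hn

/-- A trajectory of the buffer, indexed by all integer times, whose length does not tend to infinity
at `-∞` is the trajectory of the systems that are started empty in a remote past: it is below some
level at infinitely many negative times, and after one of those times it is emptied before the
times from which on the systems started empty have merged. -/
theorem Policy.IsGoodInput.pastLimit_of_not_tendsto [Finite V] {ω : Input G}
    (h : φ.IsGoodInput ω) {u : ℤ → List V} (hu : ∀ n, u n ∈ EvenQueue G)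
    (hstep : ∀ n, u (n + 1) = φ.evenStep (u n) (ω n))
    (ht : ¬ Tendsto (fun n : ℕ => (u (-(n : ℤ))).length) atTop atTop) (n : ℤ) :
    φ.PastLimit ω n (u n) := by
  have hflow : ∀ (m : ℤ) (k : ℕ), u (m + k) = φ.flow ω m (u m) k := by
    intro m k
    induction k with
    | zero => simp [Policy.flow]
    | succ k ih => rw [Policy.flow_succ, ← ih, ← hstep]; congr 1; push_cast; ring
  simp only [tendsto_atTop, not_forall, not_eventually, not_le] at ht
  obtain ⟨b, hb⟩ := ht
  obtain ⟨w, hw⟩ := h.exists_pastLimit n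
  obtain ⟨N, hN⟩ := eventually_atTop.1 hw
  have hfin : {w : List V | w ∈ EvenQueue G ∧ w.length < b}.Finite :=
    (List.finite_length_lt V b).subset fun w hw => hw.2
  have hev := hfin.eventually_all.2 fun w hw => h.eventually_empty w hw.1 (n - N)
  obtain ⟨k, hk, hk'⟩ := (hb.and_eventually hev).exists
  obtain ⟨i, -, hi, hi'⟩ := hk' _ ⟨hu _, hk⟩
  rw [← hflow] at hi'
  have h1 := hflow (-(k : ℤ) + i) (n + k - i).toNat
  rw [hi', show -(k : ℤ) + i + ((n + k - i).toNat : ℤ) = n by omega] at h1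
  have h2 := hN (n + k - i).toNat (by omega)
  rw [show n - ((n + k - i).toNat : ℤ) = -(k : ℤ) + i by omega] at h2
  rwa [h1, h2]

/-- If all the systems that are started empty long enough before time `0` have been empty before
time `0`, then their contents at time `0` form a finite set. -/
theorem Policy.exists_length_flow_le {ω : Input G} (h : ∀ᶠ k : ℕ in atTop,
      ∃ i : ℕ, 0 < i ∧ -(k : ℤ) + i ≤ 0 ∧ φ.flow ω (-k) [] i = []) :
    ∃ r : ℕ, ∀ k : ℕ, (φ.flow ω (-k) [] k).length ≤ 2 * r := by
  obtain ⟨N, hN⟩ := eventually_atTop.1 h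
  refine ⟨∑ k ∈ Finset.range N, (φ.flow ω (-k) [] k).length, fun k => ?_⟩
  induction k using Nat.strong_induction_on with
  | _ k ih =>
    by_cases hk : k < N
    · have := Finset.single_le_sum (f := fun k : ℕ => (φ.flow ω (-k) [] k).length)
        (fun _ _ => Nat.zero_le _) (Finset.mem_range.2 hk)
      omega
    · obtain ⟨i, hi0, hi, hi'⟩ := hN k (by omega)
      have := ih (k - i) (by omega)
      obtain ⟨j, rfl⟩ : ∃ j, k = i + j := ⟨k - i, by omega⟩
      rw [φ.flow_add, hi']
      rw [Nat.add_sub_cancel_left] at this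
      rwa [show -((i + j : ℕ) : ℤ) + i = -j by push_cast; ring]

end PastLimit

/-! ### Almost every input is good -/

section AlmostSure

variable {V : Type*} [MeasurableSpace V] {G : SimpleGraph V} {μ : PMF V} {φ : Policy G}

theorem isQueueRV_const {w : List V} (hw : w ∈ EvenQueue G) :
    IsQueueRV (fun _ : Input G => w) :=
  ⟨fun _ => MeasurableSet.const _, fun _ => hw⟩

variable [Finite V]

/-- Uniqueness of the stationary buffer content: by Poincaré recurrence, it does not tend to
infinity at `-∞`. -/
theorem Policy.IsStationaryBuffer.ae_eq_limitBuffer {U : Input G → List V}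
    (hU : φ.IsStationaryBuffer μ U) (hgood : ∀ᵐ ω ∂(inputLaw μ φ), φ.IsGoodInput ω) :
    ∀ᵐ ω ∂(inputLaw μ φ), U ω = φ.limitBuffer ω := by
  have hrec : ∀ᵐ ω ∂(inputLaw μ φ), ∀ w, U ω = w →
      ∃ᶠ k : ℕ in atTop, U (shift (-k) ω) = w := by
    refine ae_all_iff.2 fun w => ?_
    simpa using ae_frequently_shift_mem (μ := μ) (φ := φ) (hU.1.1 w) (-1)
  filter_upwards [hgood, hrec, ae_forall_shift hU.2] with ω hω hω' hω''
  have := hω.pastLimit_of_not_tendsto (u := fun n => U (shift n ω)) (fun n => hU.1.2 _)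
    (fun n => by
      have := hω'' n
      rw [shift_shift, add_comm] at this
      simpa [shift] using this)
    (fun ht => by
      obtain ⟨k, hk, hk'⟩ := ((hω' _ rfl).and_eventually
        (ht.eventually (eventually_gt_atTop (U ω).length))).exists
      rw [hk] at hk'
      exact lt_irrefl _ hk') 0
  rw [shift_zero] at this
  exact (Policy.limitBuffer_eq_of_pastLimit this).symm

variable [DiscreteMeasurableSpace V]

theorem measurableSet_pastLimit (φ : Policy G) (n : ℤ) (w : List V) :
    MeasurableSet {ω | φ.PastLimit ω n w} := by
  have : {ω | φ.PastLimit ω n w}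
      = ⋃ N : ℕ, ⋂ (k : ℕ) (_ : N ≤ k), {ω | φ.flow ω (n - k) [] k ∈ ({w} : Set (List V))} := by
    ext ω
    simp [Policy.PastLimit, eventually_atTop]
  rw [this]
  exact MeasurableSet.iUnion fun N => MeasurableSet.iInter fun k => MeasurableSet.iInter fun _ =>
    measurableSet_flow φ _ (W := fun _ => []) (fun _ => MeasurableSet.const _) _ _
      (fun _ _ => measurable_pi_apply _) _

/-- Under condition (H1) for the empty initial content, the compatibility graph is not bipartite:
otherwise the contents at time `0` of the systems started empty at the times `-k` would have
unbounded color differences, since long runs of a single class occur almost surely. -/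
theorem Policy.not_colorable_two (hG : G.Connected) (hμ : ∀ v : V, v ∈ μ.support)
    (h : ∀ᵐ ω ∂(inputLaw μ φ), ∃ r : ℕ, ∀ k : ℕ, (φ.flow ω (-k) [] k).length ≤ 2 * r) :
    ¬ G.Colorable 2 := by
  rintro ⟨c⟩
  obtain ⟨a⟩ := hG.nonempty
  obtain ⟨σ, hσ⟩ := φ.prefLaw.support_nonempty
  have hrun : ∀ᵐ ω ∂(inputLaw μ φ), ∀ R : ℕ, ∀ m : ℤ, ∃ n ≤ m,
      Occurs (List.replicate R ((a, σ), (a, σ))) n ω := by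
    refine ae_all_iff.2 fun R => ?_
    have := ae_exists_le_shift_mem_and_occurs hμ (A := Set.univ) MeasurableSet.univ
      (by simp : inputLaw μ φ Set.univ ≠ 0) (z := List.replicate R ((a, σ), (a, σ))) ?_
    · simpa using this
    · intro s hs
      rw [List.eq_of_mem_replicate hs]
      exact ⟨hσ, hσ⟩
  obtain ⟨ω, ⟨r, hr⟩, hω⟩ := (h.and hrun).exists
  obtain ⟨n, hn, hocc⟩ := hω (2 * r + 1) (-((2 * r + 1 : ℕ) : ℤ))
  obtain ⟨j, hj⟩ : ∃ j : ℕ, n = -((2 * r + 1 + j : ℕ) : ℤ) := ⟨(-n).toNat - (2 * r + 1), by omega⟩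
  have hrunlen := φ.flow_of_occurs hocc []
  rw [List.length_replicate] at hrunlen
  have hdiff := φ.colorDiff_flow c ω (n + (2 * r + 1 : ℕ)) (φ.flow ω n [] (2 * r + 1)) [] j
  rw [← φ.flow_add, hrunlen, φ.colorDiff_foldl_replicate] at hdiff
  have h1 := (abs_colorDiff_le c _).trans (Nat.cast_le.2 (hr (2 * r + 1 + j)))
  have h2 := (abs_colorDiff_le c _).trans (Nat.cast_le.2 (hr j))
  rw [← hj] at h1
  rw [show (-(j : ℤ)) = n + (2 * r + 1 : ℕ) by omega] at h2
  rw [abs_le] at h1 h2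
  simp only [colorDiff, List.map_nil, List.sum_nil] at hdiff h1 h2
  push_cast at hdiff h1 h2
  split_ifs at hdiff <;> linarith

/-- The input is almost surely good. Since the contents at time `0` of the systems started empty in
the past are almost surely bounded, they are bounded by some constant with positive probability;
when this happens at a time at which a word that erases all shorter contents begins to enter, all
the systems started empty before that time are empty after that word. This is a recurrent event. -/
theorem Policy.ae_isGoodInput (hG : G.Connected) (hμ : ∀ v : V, v ∈ μ.support)
    (hφ : φ.SubAdditive)
    (hH1 : ∀ Y : Input G → List V, IsBoundedQueueRV Y → φ.H1 μ Y) :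
    ∀ᵐ ω ∂(inputLaw μ φ), φ.IsGoodInput ω := by
  have hempty : ∀ᵐ ω ∂(inputLaw μ φ), ∀ w ∈ EvenQueue G, ∀ j : ℤ, ∀ᶠ k : ℕ in atTop,
      ∃ i : ℕ, 0 < i ∧ -(k : ℤ) + i ≤ j ∧ φ.flow ω (-k) w i = [] := by
    refine ae_all_iff.2 fun w => ?_
    by_cases hw : w ∈ EvenQueue G
    · filter_upwards [Policy.H1.ae_eventually_empty (isQueueRV_const hw)
        (hH1 _ ⟨isQueueRV_const hw, w.length, fun _ => by dsimp only; omega⟩)] with ω hω _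
      exact hω
    · exact Eventually.of_forall fun ω h => absurd h hw
  have hbdd : ∀ᵐ ω ∂(inputLaw μ φ), ∃ r : ℕ, ∀ k : ℕ, (φ.flow ω (-k) [] k).length ≤ 2 * r := by
    filter_upwards [hempty] with ω hω
    exact Policy.exists_length_flow_le (hω [] nil_mem_evenQueue 0)
  have h2 := φ.not_colorable_two hG hμ hbdd
  obtain ⟨σ, hσ⟩ := φ.prefLaw.support_nonempty
  set A : ℕ → Set (Input G) := fun r => {ω | ∀ k : ℕ, (φ.flow ω (-k) [] k).length ≤ 2 * r} with hA
  have hAmeas : ∀ r, MeasurableSet[inputSigma (Set.Iio 0)] (A r) := by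
    intro r
    have : A r = ⋂ k : ℕ, {ω | φ.flow ω (-k) [] k ∈ {w : List V | w.length ≤ 2 * r}} := by
      ext ω; simp [hA]
    rw [this]
    refine MeasurableSet.iInter fun k => measurableSet_flow φ _ (W := fun _ => [])
      (fun _ => MeasurableSet.const _) _ _ (fun i hi => measurable_eval_inputSigma ?_) _
    simp only [Set.mem_Iio]
    omega
  obtain ⟨r, hr⟩ : ∃ r, inputLaw μ φ (A r) ≠ 0 := by
    by_contra! hcon
    have hnull : inputLaw μ φ (⋃ r, A r) = 0 := measure_iUnion_null hcon
    have hex := (hbdd.and (measure_eq_zero_iff_ae_notMem.1 hnull)).exists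
    obtain ⟨ω, ⟨r, hr⟩, hω⟩ := hex
    exact hω (Set.mem_iUnion.2 ⟨r, hr⟩)
  obtain ⟨z, hz, hzr⟩ := φ.exists_erases hG h2 hφ hσ r
  have hbelow : ∀ᵐ ω ∂(inputLaw μ φ), ∀ m : ℤ, ∃ n < m, φ.PastLimit ω n [] := by
    filter_upwards [ae_exists_le_shift_mem_and_occurs hμ (hAmeas r) hr (z := z)
      (fun s hs => by rw [(hz s hs).1, (hz s hs).2]; exact ⟨hσ, hσ⟩)] with ω hω m
    obtain ⟨n, hn, hnA, hnz⟩ := hω (m - 1 - z.length)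
    refine ⟨n + z.length, by omega, eventually_atTop.2 ⟨z.length, fun k hk => ?_⟩⟩
    obtain ⟨j, rfl⟩ : ∃ j, k = j + z.length := ⟨k - z.length, by omega⟩
    rw [show n + z.length - ((j + z.length : ℕ) : ℤ) = -j + n by push_cast; ring, φ.flow_add,
      show -(j : ℤ) + n + j = n by ring, φ.flow_of_occurs hnz, ← φ.flow_shift]
    exact hzr _ (φ.flow_mem _ _ nil_mem_evenQueue _) (hnA j)
  have habove : ∀ᵐ ω ∂(inputLaw μ φ), ∀ m : ℤ, ∃ n > m, φ.PastLimit ω n [] := by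
    have hrec := ae_forall_shift (ae_frequently_shift_mem (μ := μ) (φ := φ)
      (measurableSet_pastLimit φ 0 []) 1)
    filter_upwards [hbelow, hrec] with ω hω hω' m
    obtain ⟨n, hn, hn'⟩ := hω m
    have h0 : shift n ω ∈ {ω | φ.PastLimit ω 0 []} := by
      simpa [Policy.pastLimit_shift] using hn'
    obtain ⟨k, hk, hk'⟩ := (frequently_atTop.1 (hω' n h0)) (m - n + 1).toNat
    refine ⟨k + n, by omega, ?_⟩
    simpa [shift_shift, Policy.pastLimit_shift] using hk'
  filter_upwards [hempty, hbelow, habove] with ω h1 h2 h3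
  exact ⟨h2, h3, h1⟩

theorem measurableSet_limitBuffer (φ : Policy G) (w : List V) :
    MeasurableSet {ω | φ.limitBuffer ω = w} := by
  have : {ω | φ.limitBuffer ω = w} = {ω | φ.PastLimit ω 0 w} ∪
      ((⋃ w', {ω | φ.PastLimit ω 0 w'})ᶜ ∩ {_ω | w = []}) := by
    ext ω
    simp only [Set.mem_ofPred_eq, Set.mem_union, Set.mem_inter_iff, Set.mem_compl_iff,
      Set.mem_iUnion, not_exists]
    by_cases h : ∃ w', φ.PastLimit ω 0 w'
    · obtain ⟨w', hw'⟩ := h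
      rw [Policy.limitBuffer_eq_of_pastLimit hw']
      refine ⟨fun h => Or.inl (h ▸ hw'), ?_⟩
      rintro (h | ⟨h, -⟩)
      · exact hw'.unique h
      · exact absurd hw' (h w')
    · have : φ.limitBuffer ω = [] := by rw [Policy.limitBuffer, dif_neg h]
      rw [this]
      refine ⟨fun h' => Or.inr ⟨fun w' hw' => h ⟨w', hw'⟩, h'.symm⟩, ?_⟩
      rintro (h' | ⟨-, h'⟩)
      · exact absurd ⟨w, h'⟩ h
      · exact h'.symm
  rw [this]
  exact (measurableSet_pastLimit φ 0 w).union
    ((MeasurableSet.iUnion fun w' => measurableSet_pastLimit φ 0 w').compl.inter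
      (MeasurableSet.const _))

theorem isQueueRV_limitBuffer (φ : Policy G) : IsQueueRV φ.limitBuffer := by
  refine ⟨measurableSet_limitBuffer φ, fun ω => ?_⟩
  by_cases h : ∃ w, φ.PastLimit ω 0 w
  · obtain ⟨w, hw⟩ := h
    rw [Policy.limitBuffer_eq_of_pastLimit hw]
    exact hw.mem
  · rw [Policy.limitBuffer, dif_neg h]
    exact nil_mem_evenQueue

theorem Policy.isStationaryBuffer_limitBuffer
    (hgood : ∀ᵐ ω ∂(inputLaw μ φ), φ.IsGoodInput ω) :
    φ.IsStationaryBuffer μ φ.limitBuffer := by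
  refine ⟨isQueueRV_limitBuffer φ, ?_⟩
  filter_upwards [hgood] with ω hω
  have h0 := (hω.pastLimit_limitBuffer 0).flow 1
  have h1 := hω.pastLimit_limitBuffer 1
  have := h1.unique (by simpa using h0)
  simp [this, Policy.flow, shift_zero]

end AlmostSure


/-! ### Trajectories of the list of stored items and their matchings -/

section Trajectories

variable {V : Type*} {G : SimpleGraph V} (φ : Policy G)

/-- The classes of the items in the list `b`. -/
def itemClasses (ω : Input G) (b : List ℤ) : List V := b.map fun r => (itemAt ω r).1

theorem itemAt_two_mul (ω : Input G) (n : ℤ) : itemAt ω (2 * n) = (ω n).1 := by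
  simp [itemAt]

theorem itemAt_two_mul_add_one (ω : Input G) (n : ℤ) : itemAt ω (2 * n + 1) = (ω n).2 := by
  rw [itemAt, if_neg (by simp)]
  congr 2
  omega

/-- The policy matches the arriving item `t` with the item `s` of the list `b` of stored items. -/
def Policy.Selects (ω : Input G) (b : List ℤ) (t s : ℤ) : Prop :=
  ∃ i : Fin (itemClasses ω b).length,
    φ.choice (itemClasses ω b) (itemAt ω t).1 (itemAt ω t).2 = some i ∧ b[(i : ℕ)]? = some s

/-- The list of stored items after the arrival of item `t`, if it was `b` just before. -/
def Policy.labelStep (ω : Input G) (b : List ℤ) (t : ℤ) : List ℤ :=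
  match φ.choice (itemClasses ω b) (itemAt ω t).1 (itemAt ω t).2 with
  | none => b ++ [t]
  | some i => b.eraseIdx i

/-- A trajectory of the list of stored items (sorted by time of arrival) that is indexed by all
integer times and follows the policy. -/
structure Policy.IsTrajectory (ω : Input G) (L : ℤ → List ℤ) : Prop where
  pairwise : ∀ t, (L t).Pairwise (· < ·)
  lt_of_mem : ∀ t, ∀ s ∈ L t, s < t
  step : ∀ t, L (t + 1) = φ.labelStep ω (L t) t

/-- The graph in which every item is matched upon its arrival with the item that the policy selects
in the list given by the trajectory `L`. -/
def Policy.matchGraph (ω : Input G) (L : ℤ → List ℤ) : SimpleGraph ℤ :=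
  SimpleGraph.fromRel fun s t => φ.Selects ω (L t) t s

variable {φ} {ω : Input G} {b : List ℤ} {s t : ℤ}

theorem Policy.Selects.mem (h : φ.Selects ω b t s) : s ∈ b := by
  obtain ⟨i, -, hi⟩ := h
  exact List.mem_of_getElem? hi

theorem Policy.Selects.unique {s' : ℤ} (h : φ.Selects ω b t s) (h' : φ.Selects ω b t s') :
    s = s' := by
  obtain ⟨i, hi, his⟩ := h
  obtain ⟨j, hj, hjs⟩ := h'
  obtain rfl : i = j := by rw [hi] at hj; exact Option.some.inj hj
  rw [his] at hjs
  exact Option.some.inj hjs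

theorem Policy.choice_eq_none_of_forall_not_selects (h : ∀ r, ¬ φ.Selects ω b t r) :
    φ.choice (itemClasses ω b) (itemAt ω t).1 (itemAt ω t).2 = none := by
  rcases hc : φ.choice (itemClasses ω b) (itemAt ω t).1 (itemAt ω t).2 with _ | i
  · rfl
  · have hi : (i : ℕ) < b.length := by simpa [itemClasses] using i.2
    exact absurd ⟨i, hc, List.getElem?_eq_getElem hi⟩ (h b[i])

theorem Policy.labelStep_of_none {w : List V} (hw : itemClasses ω b = w)
    (hc : φ.choice w (itemAt ω t).1 (itemAt ω t).2 = none) : φ.labelStep ω b t = b ++ [t] := by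
  subst hw
  simp [Policy.labelStep, hc]

theorem Policy.labelStep_of_some {w : List V} {i : Fin w.length} (hw : itemClasses ω b = w)
    (hc : φ.choice w (itemAt ω t).1 (itemAt ω t).2 = some i) :
    φ.labelStep ω b t = b.eraseIdx i := by
  subst hw
  simp [Policy.labelStep, hc]

theorem Policy.itemClasses_labelStep :
    itemClasses ω (φ.labelStep ω b t) = φ.act (itemClasses ω b) (itemAt ω t) := by
  rcases hc : φ.choice (itemClasses ω b) (itemAt ω t).1 (itemAt ω t).2 with _ | i
  · rw [φ.act_of_none hc, Policy.labelStep_of_none rfl hc]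
    simp [itemClasses]
  · rw [φ.act_of_some hc, Policy.labelStep_of_some rfl hc]
    simp [itemClasses, List.eraseIdx_map]

theorem Policy.mem_labelStep (hb : b.Nodup) : s ∈ φ.labelStep ω b t ↔
    (s ∈ b ∧ ¬ φ.Selects ω b t s) ∨ (s = t ∧ ∀ r, ¬ φ.Selects ω b t r) := by
  rw [Policy.labelStep]
  rcases hc : φ.choice (itemClasses ω b) (itemAt ω t).1 (itemAt ω t).2 with _ | i
  · have h : ∀ r, ¬ φ.Selects ω b t r := by
      rintro r ⟨i, hi, -⟩
      rw [hc] at hi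
      exact Option.some_ne_none _ hi.symm
    simp [h]
  · have hi : (i : ℕ) < b.length := by simpa [itemClasses] using i.2
    have h : φ.Selects ω b t b[(i : ℕ)] := ⟨i, hc, List.getElem?_eq_getElem hi⟩
    have hiff : ∀ r, φ.Selects ω b t r ↔ r = b[(i : ℕ)] :=
      fun r => ⟨fun hr => hr.unique h, fun hr => hr ▸ h⟩
    simp only [hiff, List.mem_eraseIdx_iff_getElem, exists_and_left]
    constructor
    · rintro ⟨j, hji, hj, rfl⟩
      exact Or.inl ⟨List.getElem_mem _, fun h => hji ((List.Nodup.getElem_inj_iff hb).1 h)⟩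
    · rintro (⟨hs, hne⟩ | ⟨-, hall⟩)
      · obtain ⟨j, hj, rfl⟩ := List.getElem_of_mem hs
        exact ⟨j, fun h => hne (by simp [h]), hj, rfl⟩
      · exact absurd rfl (hall _)

theorem Policy.pairwise_labelStep (hb : b.Pairwise (· < ·)) (ht : ∀ s ∈ b, s < t) :
    (φ.labelStep ω b t).Pairwise (· < ·) := by
  rw [Policy.labelStep]
  rcases hc : φ.choice (itemClasses ω b) (itemAt ω t).1 (itemAt ω t).2 with _ | i
  · simpa [List.pairwise_append, hb] using ht
  · exact hb.sublist (List.eraseIdx_sublist _ _)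

theorem Policy.lt_of_mem_labelStep (ht : ∀ s ∈ b, s < t) :
    ∀ s ∈ φ.labelStep ω b t, s < t + 1 := by
  intro s hs
  rw [Policy.labelStep] at hs
  rcases hc : φ.choice (itemClasses ω b) (itemAt ω t).1 (itemAt ω t).2 with _ | i
  · simp only [hc, List.mem_append, List.mem_singleton] at hs
    rcases hs with hs | rfl
    · have := ht s hs; omega
    · omega
  · simp only [hc] at hs
    have := ht s (List.mem_of_mem_eraseIdx hs)
    omega

theorem Policy.IsTrajectory.itemClasses_eq_flow {L : ℤ → List ℤ} (h : φ.IsTrajectory ω L) (n : ℤ)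
    (k : ℕ) : itemClasses ω (L (2 * (n + k))) = φ.flow ω n (itemClasses ω (L (2 * n))) k := by
  induction k with
  | zero => simp [Policy.flow]
  | succ k ih =>
    rw [Policy.flow_succ, ← ih, show 2 * (n + (k + 1 : ℕ)) = 2 * (n + k) + 1 + 1 by push_cast; ring,
      h.step, Policy.itemClasses_labelStep, h.step, Policy.itemClasses_labelStep, Policy.evenStep]
    rw [itemAt_two_mul, itemAt_two_mul_add_one]

theorem itemClasses_eq_nil : itemClasses ω b = [] ↔ b = [] := by
  simp [itemClasses]

theorem Policy.IsTrajectory.matchGraph_adj {L : ℤ → List ℤ} (h : φ.IsTrajectory ω L)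
    (hst : s < t) : (φ.matchGraph ω L).Adj s t ↔ φ.Selects ω (L t) t s := by
  rw [Policy.matchGraph, SimpleGraph.fromRel_adj]
  refine ⟨?_, fun h => ⟨hst.ne, Or.inl h⟩⟩
  rintro ⟨-, h' | h'⟩
  · exact h'
  · exact absurd (h.lt_of_mem _ _ h'.mem) hst.not_gt

/-- After a time `c` at which the list is empty, the list consists of the items that arrived from
time `c` on and have no match among the items that have arrived. -/
theorem Policy.IsTrajectory.mem_iff {L : ℤ → List ℤ} (h : φ.IsTrajectory ω L) {c : ℤ}
    (hc : L c = []) (hct : c ≤ t) :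
    s ∈ L t ↔ c ≤ s ∧ s < t ∧ ∀ r < t, ¬ (φ.matchGraph ω L).Adj s r := by
  induction t, hct using Int.leInduction with
  | base =>
    simp only [hc, List.not_mem_nil, false_iff]
    rintro ⟨h1, h2, -⟩
    omega
  | succ t hct ih =>
    rw [h.step, Policy.mem_labelStep (h.pairwise t).nodup, ih]
    constructor
    · rintro (⟨⟨h1, h2, h3⟩, h4⟩ | ⟨rfl, h4⟩)
      · refine ⟨h1, by omega, fun r hr => ?_⟩
        rcases (Int.lt_add_one_iff.1 hr).lt_or_eq with hr | rfl
        · exact h3 r hr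
        · rwa [h.matchGraph_adj h2]
      · refine ⟨hct, by omega, fun r hr => ?_⟩
        rcases (Int.lt_add_one_iff.1 hr).lt_or_eq with hr | rfl
        · rw [SimpleGraph.adj_comm, h.matchGraph_adj hr]
          exact h4 r
        · exact SimpleGraph.irrefl _
    · rintro ⟨h1, h2, h3⟩
      rcases (Int.lt_add_one_iff.1 h2).lt_or_eq with hs | rfl
      · exact Or.inl ⟨⟨h1, hs, fun r hr => h3 r (by omega)⟩,
          (h.matchGraph_adj hs).not.1 (h3 t (by omega))⟩
      · refine Or.inr ⟨rfl, fun r hr => ?_⟩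
        have hrs := h.lt_of_mem _ _ hr.mem
        exact h3 r (by omega) ((h.matchGraph_adj hrs).2 hr).symm

theorem Policy.IsTrajectory.stored_eq {L : ℤ → List ℤ} (h : φ.IsTrajectory ω L)
    (hlow : ∀ m, ∃ c < m, L c = []) (t : ℤ) :
    stored (φ.matchGraph ω L) t = {s | s ∈ L t} := by
  ext s
  obtain ⟨c, hc, hc'⟩ := hlow (min s t)
  have := h.mem_iff (s := s) hc' (t := t) (by omega)
  simp only [stored, Set.mem_ofPred_eq, this]
  exact ⟨fun h => ⟨by omega, h⟩, fun h => h.2⟩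

theorem Policy.IsTrajectory.storedList_eq {L : ℤ → List ℤ} (h : φ.IsTrajectory ω L)
    (hlow : ∀ m, ∃ c < m, L c = []) (t : ℤ) :
    storedList (φ.matchGraph ω L) t = L t := by
  have hfin : (stored (φ.matchGraph ω L) t).Finite := by
    rw [h.stored_eq hlow]; exact List.finite_toSet _
  rw [storedList, dif_pos hfin]
  refine (Finset.sortedLT_sort _).pairwise.eq_of_mem_iff (h.pairwise t) fun a => ?_
  simp [h.stored_eq hlow]

theorem Policy.IsTrajectory.even_length {L : ℤ → List ℤ} (h : φ.IsTrajectory ω L)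
    (hlow : ∀ m, ∃ c < m, L (2 * c) = []) (n : ℤ) : Even (L (2 * n)).length := by
  obtain ⟨c, hc, hc'⟩ := hlow n
  have h1 := h.itemClasses_eq_flow c (n - c).toNat
  rw [hc', show c + ((n - c).toNat : ℤ) = n by omega] at h1
  have h2 := (φ.flow_mem ω c nil_mem_evenQueue (n - c).toNat).2
  rw [show itemClasses ω [] = [] from rfl] at h1
  rw [← h1] at h2
  simpa [itemClasses] using h2

/-- A trajectory that is empty at arbitrarily remote even times in the past defines a bi-infinite
matching. -/
theorem Policy.IsTrajectory.isBiinfiniteMatching {L : ℤ → List ℤ} (h : φ.IsTrajectory ω L)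
    (hlow : ∀ m, ∃ c < m, L (2 * c) = []) : φ.IsBiinfiniteMatching ω (φ.matchGraph ω L) := by
  have hlow' : ∀ m, ∃ c < m, L c = [] := fun m => by
    obtain ⟨c, hc, hc'⟩ := hlow (min m 0)
    exact ⟨2 * c, by omega, hc'⟩
  refine ⟨?_, fun t => ?_, fun s t hst => ?_, fun n => ?_⟩
  · -- a stored item has no match yet, so an item is matched at most once
    have key : ∀ s t t' : ℤ, t < t' → (φ.matchGraph ω L).Adj s t →
        ¬ (φ.matchGraph ω L).Adj s t' := by
      intro s t t' htt' hst hst'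
      rcases lt_trichotomy s t' with hs | rfl | hs
      · have := ((h.matchGraph_adj hs).1 hst').mem
        have hmem : s ∈ stored (φ.matchGraph ω L) t' := by
          rw [h.stored_eq hlow']; exact this
        exact hmem.2 t htt' hst
      · exact SimpleGraph.irrefl _ hst'
      · have h1 := (h.matchGraph_adj hs).1 hst'.symm
        have h2 := (h.matchGraph_adj (htt'.trans hs)).1 hst.symm
        exact htt'.ne (h2.unique h1)
    intro s t t' hst hst'
    rcases lt_trichotomy t t' with htt' | rfl | htt'
    · exact absurd hst' (key _ _ _ htt' hst)
    · rfl
    · exact absurd hst (key _ _ _ htt' hst')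
  · rw [h.stored_eq hlow']; exact List.finite_toSet _
  · rw [h.storedList_eq hlow']
    exact h.matchGraph_adj hst
  · rw [h.storedList_eq hlow']
    exact h.even_length hlow n

/-- If moreover the trajectory is empty at arbitrarily remote times in the future, the matching is
perfect. -/
theorem Policy.IsTrajectory.isPerfect {L : ℤ → List ℤ} (h : φ.IsTrajectory ω L)
    (hlow : ∀ m, ∃ c < m, L c = []) (hhigh : ∀ m, ∃ c > m, L c = []) :
    IsPerfect (φ.matchGraph ω L) := by
  intro s
  obtain ⟨c, hc, hc'⟩ := hhigh s
  have hs : s ∉ stored (φ.matchGraph ω L) c := by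
    rw [h.stored_eq hlow, hc']; simp
  by_contra hcon
  push Not at hcon
  exact hs ⟨hc, fun r _ => hcon r⟩

end Trajectories

/-! ### The trajectory of a bi-infinite matching -/

section Biinfinite

variable {V : Type*} {G : SimpleGraph V} {φ : Policy G} {ω : Input G} {H : SimpleGraph ℤ}

theorem length_storedList (H : SimpleGraph ℤ) (t : ℤ) :
    (storedList H t).length = (stored H t).ncard := by
  rw [storedList]
  split_ifs with h
  · rw [Finset.length_sort, Set.ncard_eq_toFinset_card _ h]
  · rw [Set.Infinite.ncard h, List.length_nil]

theorem Policy.IsBiinfiniteMatching.mem_storedList (h : φ.IsBiinfiniteMatching ω H) {s t : ℤ} :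
    s ∈ storedList H t ↔ s ∈ stored H t := by
  rw [storedList, dif_pos (h.finite_stored t)]
  simp

theorem Policy.IsBiinfiniteMatching.adj_iff_selects (h : φ.IsBiinfiniteMatching ω H) {s t : ℤ}
    (hst : s < t) : H.Adj s t ↔ φ.Selects ω (storedList H t) t s := h.adj_iff s t hst

theorem Policy.IsBiinfiniteMatching.isTrajectory (h : φ.IsBiinfiniteMatching ω H) :
    φ.IsTrajectory ω (storedList H) := by
  have hpw : ∀ t, (storedList H t).Pairwise (· < ·) := fun t => by
    rw [storedList, dif_pos (h.finite_stored t)]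
    exact (Finset.sortedLT_sort _).pairwise
  have hlt : ∀ t, ∀ s ∈ storedList H t, s < t := fun t s hs => (h.mem_storedList.1 hs).1
  refine ⟨hpw, hlt, fun t => ?_⟩
  refine (hpw _).eq_of_mem_iff (Policy.pairwise_labelStep (hpw t) (hlt t)) fun s => ?_
  rw [h.mem_storedList, Policy.mem_labelStep (hpw t).nodup, h.mem_storedList]
  constructor
  · rintro ⟨hs, hs'⟩
    rcases (Int.lt_add_one_iff.1 hs).lt_or_eq with hs | rfl
    · exact Or.inl ⟨⟨hs, fun r hr => hs' r (by omega)⟩,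
        (h.adj_iff_selects hs).not.1 (hs' t (by omega))⟩
    · refine Or.inr ⟨rfl, fun r hr => ?_⟩
      have hrs := hlt _ _ hr.mem
      exact hs' r (by omega) ((h.adj_iff_selects hrs).2 hr).symm
  · rintro (⟨⟨hs, hs'⟩, hsel⟩ | ⟨rfl, hsel⟩)
    · refine ⟨by omega, fun r hr => ?_⟩
      rcases (Int.lt_add_one_iff.1 hr).lt_or_eq with hr | rfl
      · exact hs' r hr
      · rwa [h.adj_iff_selects hs]
    · refine ⟨by omega, fun r hr => ?_⟩
      rcases (Int.lt_add_one_iff.1 hr).lt_or_eq with hr | rfl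
      · rw [SimpleGraph.adj_comm, h.adj_iff_selects hr]
        exact hsel r
      · exact SimpleGraph.irrefl _

/-- The buffer content of a bi-infinite matching is an admissible word of even length at even
times: an item that is stored was not compatible with the items stored upon its arrival. -/
theorem Policy.IsBiinfiniteMatching.itemClasses_mem (h : φ.IsBiinfiniteMatching ω H) (n : ℤ) :
    itemClasses ω (storedList H (2 * n)) ∈ EvenQueue G := by
  have key : ∀ t s s' : ℤ, s ∈ storedList H t → s' ∈ storedList H t → s < s' →
      ¬ G.Adj (itemAt ω s').1 (itemAt ω s).1 := by
    intro t s s' hs hs' hss'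
    rw [h.mem_storedList] at hs hs'
    have hmem : s ∈ storedList H s' :=
      h.mem_storedList.2 ⟨hss', fun r hr => hs.2 r (hr.trans hs'.1)⟩
    have hnone : ∀ r, ¬ φ.Selects ω (storedList H s') s' r := by
      intro r hr
      have hrs := h.isTrajectory.lt_of_mem _ _ hr.mem
      exact hs'.2 r (hrs.trans hs'.1) ((h.adj_iff_selects hrs).2 hr).symm
    exact φ.not_adj_of_none _ _ _ (Policy.choice_eq_none_of_forall_not_selects hnone) _
      (List.mem_map_of_mem hmem)
  refine ⟨?_, by simpa [itemClasses] using h.even_stored n⟩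
  intro a ha a' ha'
  obtain ⟨s, hs, rfl⟩ := List.mem_map.1 ha
  obtain ⟨s', hs', rfl⟩ := List.mem_map.1 ha'
  rcases lt_trichotomy s s' with hss' | rfl | hss'
  · exact fun hadj => key _ s s' hs hs' hss' hadj.symm
  · exact G.irrefl
  · exact key _ s' s hs' hs hss'

theorem Policy.IsBiinfiniteMatching.eq_matchGraph (h : φ.IsBiinfiniteMatching ω H) :
    H = φ.matchGraph ω (storedList H) := by
  ext s t
  rcases lt_trichotomy s t with hst | rfl | hst
  · rw [h.adj_iff_selects hst, h.isTrajectory.matchGraph_adj hst]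
  · simp
  · rw [SimpleGraph.adj_comm, h.adj_iff_selects hst, SimpleGraph.adj_comm,
      h.isTrajectory.matchGraph_adj hst]

end Biinfinite

/-! ### Matchings of good inputs -/

section Good

variable {V : Type*} {G : SimpleGraph V} (φ : Policy G) {ω : Input G}

/-- The list of stored items just before the arrival of item `m + j`, in the system that is started
empty just before the arrival of item `m`. -/
def Policy.run (ω : Input G) (m : ℤ) : ℕ → List ℤ
  | 0 => []
  | j + 1 => φ.labelStep ω (Policy.run ω m j) (m + j)

variable {φ}

theorem Policy.pairwise_run (m : ℤ) (j : ℕ) :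
    (φ.run ω m j).Pairwise (· < ·) ∧ ∀ s ∈ φ.run ω m j, s < m + j := by
  induction j with
  | zero => simp [Policy.run]
  | succ j ih =>
    refine ⟨Policy.pairwise_labelStep ih.1 ih.2, fun s hs => ?_⟩
    have := Policy.lt_of_mem_labelStep ih.2 s hs
    push_cast
    omega

theorem Policy.itemClasses_run (n : ℤ) (k : ℕ) :
    itemClasses ω (φ.run ω (2 * n) (2 * k)) = φ.flow ω n [] k := by
  induction k with
  | zero => rfl
  | succ k ih =>
    rw [Policy.flow_succ, ← ih, mul_add, mul_one, Policy.run, Policy.itemClasses_labelStep,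
      Policy.run, Policy.itemClasses_labelStep, Policy.evenStep]
    rw [show 2 * n + ((2 * k : ℕ) : ℤ) = 2 * (n + k) by push_cast; ring, itemAt_two_mul,
      show 2 * n + ((2 * k + 1 : ℕ) : ℤ) = 2 * (n + k) + 1 by push_cast; ring,
      itemAt_two_mul_add_one]

theorem Policy.run_add_of_eq_nil {m : ℤ} {j : ℕ} (h : φ.run ω m j = []) (k : ℕ) :
    φ.run ω m (j + k) = φ.run ω (m + j) k := by
  induction k with
  | zero => exact h
  | succ k ih =>
    rw [← add_assoc, Policy.run, ih, Policy.run]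
    congr 1
    push_cast
    ring

/-- The construction points define a trajectory of the list of stored items: at any time, run the
policy from any earlier construction point. -/
theorem Policy.IsGoodInput.exists_isTrajectory (h : φ.IsGoodInput ω) :
    ∃ L, φ.IsTrajectory ω L ∧ ∀ c, φ.PastLimit ω c [] → L (2 * c) = [] := by
  have hle : ∀ c c' : ℤ, φ.PastLimit ω c [] → φ.PastLimit ω c' [] → c ≤ c' → ∀ t, 2 * c' ≤ t →
      φ.run ω (2 * c) (t - 2 * c).toNat = φ.run ω (2 * c') (t - 2 * c').toNat := by
    intro c c' hc hc' hcc' t ht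
    have hnil : φ.run ω (2 * c) (2 * (c' - c).toNat) = [] := by
      rw [← itemClasses_eq_nil (ω := ω), Policy.itemClasses_run]
      have := hc.flow (c' - c).toNat
      rw [show c + ((c' - c).toNat : ℤ) = c' by omega] at this
      exact this.unique hc'
    have := Policy.run_add_of_eq_nil hnil (t - 2 * c').toNat
    rw [show 2 * (c' - c).toNat + (t - 2 * c').toNat = (t - 2 * c).toNat by omega,
      show 2 * c + ((2 * (c' - c).toNat : ℕ) : ℤ) = 2 * c' by omega] at this
    exact this
  have hindep : ∀ c c' : ℤ, φ.PastLimit ω c [] → φ.PastLimit ω c' [] → ∀ t, 2 * c ≤ t →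
      2 * c' ≤ t →
      φ.run ω (2 * c) (t - 2 * c).toNat = φ.run ω (2 * c') (t - 2 * c').toNat := by
    intro c c' hc hc' t ht ht'
    rcases le_total c c' with hcc' | hcc'
    · exact hle c c' hc hc' hcc' t ht'
    · exact (hle c' c hc' hc hcc' t ht).symm
  choose c hc hc' using h.exists_lt
  set L : ℤ → List ℤ := fun t => φ.run ω (2 * c (t / 2)) (t - 2 * c (t / 2)).toNat with hL
  have hLeq : ∀ d, φ.PastLimit ω d [] → ∀ t, 2 * d ≤ t →
      L t = φ.run ω (2 * d) (t - 2 * d).toNat := fun d hd t ht =>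
    hindep _ _ (hc' _) hd t (by have := hc (t / 2); omega) ht
  refine ⟨L, ⟨fun t => (Policy.pairwise_run _ _).1, fun t s hs => ?_, fun t => ?_⟩, fun d hd => ?_⟩
  · have h1 := (Policy.pairwise_run _ _).2 s hs
    have h2 := hc (t / 2)
    omega
  · have hct : 2 * c (t / 2) ≤ t := by have := hc (t / 2); omega
    rw [hLeq _ (hc' (t / 2)) (t + 1) (by omega), hLeq _ (hc' (t / 2)) t hct,
      show (t + 1 - 2 * c (t / 2)).toNat = (t - 2 * c (t / 2)).toNat + 1 by omega, Policy.run]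
    congr 1
    omega
  · rw [hLeq d hd _ le_rfl, sub_self]
    rfl

/-- A list of arrived items, in the form in which it appears in `Policy.labelledBuffer`: as nodes,
together with their classes. -/
def labelled (ω : Input G) (b : List ℤ) : List (Node × V) :=
  b.map fun r => (Sum.inr r, (itemAt ω r).1)

theorem map_snd_labelled (b : List ℤ) : (labelled ω b).map Prod.snd = itemClasses ω b := by
  simp [labelled, itemClasses]

theorem Policy.labelledBuffer_succ_of_none {y w : List V} {m : ℤ} {j : ℕ}
    (hw : (φ.labelledBuffer y m ω j).map Prod.snd = w)
    (hc : φ.choice w (itemAt ω (2 * m + j)).1 (itemAt ω (2 * m + j)).2 = none) :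
    φ.labelledBuffer y m ω (j + 1) = φ.labelledBuffer y m ω j ++
      [(Sum.inr (2 * m + j), (itemAt ω (2 * m + j)).1)] := by
  subst hw
  simp [Policy.labelledBuffer, hc]

theorem Policy.labelledBuffer_succ_of_some {y w : List V} {m : ℤ} {j : ℕ} {i : Fin w.length}
    (hw : (φ.labelledBuffer y m ω j).map Prod.snd = w)
    (hc : φ.choice w (itemAt ω (2 * m + j)).1 (itemAt ω (2 * m + j)).2 = some i) :
    φ.labelledBuffer y m ω (j + 1) = (φ.labelledBuffer y m ω j).eraseIdx i := by
  subst hw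
  simp [Policy.labelledBuffer, hc]

theorem Policy.labelledBuffer_succ_of_eq {y : List V} {m : ℤ} {j : ℕ} {b : List ℤ}
    (h : φ.labelledBuffer y m ω j = labelled ω b) :
    φ.labelledBuffer y m ω (j + 1) = labelled ω (φ.labelStep ω b (2 * m + j)) := by
  have hw := congrArg (List.map Prod.snd) h
  rw [map_snd_labelled] at hw
  rw [Policy.labelStep]
  rcases hc : φ.choice (itemClasses ω b) (itemAt ω (2 * m + j)).1 (itemAt ω (2 * m + j)).2
    with _ | i
  · rw [Policy.labelledBuffer_succ_of_none hw hc, h]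
    simp [labelled]
  · rw [Policy.labelledBuffer_succ_of_some hw hc, h]
    simp [labelled, List.eraseIdx_map]

theorem Policy.matchedUponArrival_iff {y : List V} {m : ℤ} {j : ℕ} {b : List ℤ}
    (h : φ.labelledBuffer y m ω j = labelled ω b) {z : Node} :
    φ.MatchedUponArrival y m ω j z ↔ ∃ s, z = Sum.inr s ∧ φ.Selects ω b (2 * m + j) s := by
  rw [Policy.MatchedUponArrival, h, map_snd_labelled]
  have hmap : (labelled ω b).map Prod.fst = b.map Sum.inr := by simp [labelled]
  simp only [hmap, List.getElem?_map, Option.map_eq_some_iff, Policy.Selects]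
  constructor
  · rintro ⟨i, hi, s, hs, rfl⟩
    exact ⟨s, rfl, i, hi, hs⟩
  · rintro ⟨s, rfl, i, hi, hs⟩
    exact ⟨i, hi, s, hs, rfl⟩

/-- Once the system that starts at time `m` with the content `y` is empty at a time at which the
trajectory `L` is empty, the two contain the same items. -/
theorem Policy.IsTrajectory.labelledBuffer_eq {L : ℤ → List ℤ} (hL : φ.IsTrajectory ω L)
    {y : List V} {m : ℤ} {j : ℕ} (h : φ.labelledBuffer y m ω j = []) (hLj : L (2 * m + j) = [])
    (k : ℕ) : φ.labelledBuffer y m ω (j + k) = labelled ω (L (2 * m + (j + k : ℕ))) := by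
  induction k with
  | zero => simp [h, hLj, labelled]
  | succ k ih =>
    rw [← add_assoc, Policy.labelledBuffer_succ_of_eq ih, ← hL.step]
    congr 2
    push_cast
    ring

theorem Policy.map_snd_labelledBuffer_succ (y : List V) (m : ℤ) (j : ℕ) :
    (φ.labelledBuffer y m ω (j + 1)).map Prod.snd
      = φ.act ((φ.labelledBuffer y m ω j).map Prod.snd) (itemAt ω (2 * m + j)) := by
  rcases hc : φ.choice ((φ.labelledBuffer y m ω j).map Prod.snd) (itemAt ω (2 * m + j)).1
    (itemAt ω (2 * m + j)).2 with _ | i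
  · rw [Policy.labelledBuffer_succ_of_none rfl hc, φ.act_of_none hc, List.map_append]
    rfl
  · rw [Policy.labelledBuffer_succ_of_some rfl hc, φ.act_of_some hc, List.eraseIdx_map]

theorem Policy.map_snd_labelledBuffer (y : List V) (m : ℤ) (k : ℕ) :
    (φ.labelledBuffer y m ω (2 * k)).map Prod.snd = φ.flow ω m y k := by
  induction k with
  | zero =>
    simp only [Policy.labelledBuffer, Policy.flow, List.map_map]
    exact List.zipIdx_map_fst 0 y
  | succ k ih =>
    rw [Policy.flow_succ, ← ih, mul_add, mul_one, Policy.map_snd_labelledBuffer_succ,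
      Policy.map_snd_labelledBuffer_succ, Policy.evenStep]
    rw [show 2 * m + ((2 * k : ℕ) : ℤ) = 2 * (m + k) by push_cast; ring, itemAt_two_mul,
      show 2 * m + ((2 * k + 1 : ℕ) : ℤ) = 2 * (m + k) + 1 by push_cast; ring,
      itemAt_two_mul_add_one]

theorem Policy.lt_of_mem_labelledBuffer {y : List V} {m : ℤ} {j : ℕ} {r : ℤ}
    (h : Sum.inr r ∈ (φ.labelledBuffer y m ω j).map Prod.fst) : r < 2 * m + j := by
  induction j with
  | zero => simp [Policy.labelledBuffer] at h
  | succ j ih =>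
    rw [Policy.labelledBuffer] at h
    push_cast
    split at h
    · simp only [List.map_append, List.map_cons, List.map_nil, List.mem_append,
        List.mem_singleton, Sum.inr.injEq] at h
      rcases h with h | rfl
      · have := ih h; omega
      · omega
    · rw [← List.eraseIdx_map] at h
      have := ih (List.mem_of_mem_eraseIdx h)
      omega

theorem Policy.finiteMatching_adj {y : List V} {m n : ℤ} {x z : Node} :
    (φ.finiteMatching y m n ω).Adj x z ↔ x ≠ z ∧
      ((∃ j : ℕ, 2 * m + (j : ℤ) < 2 * n ∧ x = Sum.inr (2 * m + (j : ℤ)) ∧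
        φ.MatchedUponArrival y m ω j z) ∨
      (∃ j : ℕ, 2 * m + (j : ℤ) < 2 * n ∧ z = Sum.inr (2 * m + (j : ℤ)) ∧
        φ.MatchedUponArrival y m ω j x)) :=
  SimpleGraph.fromRel_adj _ _ _

theorem Policy.infiniteMatching_adj {y : List V} {m : ℤ} {x z : Node} :
    (φ.infiniteMatching y m ω).Adj x z ↔ x ≠ z ∧
      ((∃ j : ℕ, x = Sum.inr (2 * m + (j : ℤ)) ∧ φ.MatchedUponArrival y m ω j z) ∨
      (∃ j : ℕ, z = Sum.inr (2 * m + (j : ℤ)) ∧ φ.MatchedUponArrival y m ω j x)) := by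
  simp only [Policy.infiniteMatching, SimpleGraph.iSup_adj, Policy.finiteMatching_adj]
  constructor
  · rintro ⟨n, hne, ⟨j, -, h⟩ | ⟨j, -, h⟩⟩
    · exact ⟨hne, Or.inl ⟨j, h⟩⟩
    · exact ⟨hne, Or.inr ⟨j, h⟩⟩
  · rintro ⟨hne, ⟨j, h⟩ | ⟨j, h⟩⟩
    · exact ⟨m + j + 1, hne, Or.inl ⟨j, by omega, h⟩⟩
    · exact ⟨m + j + 1, hne, Or.inr ⟨j, by omega, h⟩⟩

/-- The union of the matchings between consecutive construction points is the matching defined by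
the trajectory. -/
theorem Policy.IsGoodInput.stationaryMatching_eq (h : φ.IsGoodInput ω) {L : ℤ → List ℤ}
    (hL : φ.IsTrajectory ω L) (hnil : ∀ c, φ.PastLimit ω c [] → L (2 * c) = []) :
    φ.stationaryMatching φ.limitBuffer ω = φ.matchGraph ω L := by
  have hsel : ∀ c, φ.PastLimit ω c [] → ∀ (j : ℕ) (z : Node),
      φ.MatchedUponArrival [] c ω j z ↔
        ∃ s, z = Sum.inr s ∧ φ.Selects ω (L (2 * c + j)) (2 * c + j) s := by
    intro c hc j z
    refine Policy.matchedUponArrival_iff ?_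
    have := hL.labelledBuffer_eq (y := []) (m := c) (j := 0) rfl (by simpa using hnil c hc) j
    simpa using this
  have hcp : ∀ n, n ∈ constructionPoints φ.limitBuffer ω ↔ φ.PastLimit ω n [] :=
    fun n => h.mem_constructionPoints
  ext s t
  simp only [Policy.stationaryMatching, SimpleGraph.iSup_adj, SimpleGraph.comap_adj, hcp,
    Policy.finiteMatching_adj]
  rw [Policy.matchGraph, SimpleGraph.fromRel_adj]
  constructor
  · rintro ⟨c, c', ⟨hc, -⟩, hne, ⟨j, -, h1, h2⟩ | ⟨j, -, h1, h2⟩⟩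
    · obtain ⟨s', hs', hs''⟩ := (hsel c hc j _).1 h2
      obtain rfl := Sum.inr_injective h1
      obtain rfl := Sum.inr_injective hs'
      exact ⟨fun h => hne (by rw [h]), Or.inr hs''⟩
    · obtain ⟨s', hs', hs''⟩ := (hsel c hc j _).1 h2
      obtain rfl := Sum.inr_injective h1
      obtain rfl := Sum.inr_injective hs'
      exact ⟨fun h => hne (by rw [h]), Or.inl hs''⟩
  · -- the two construction points around a given time
    have hcons : ∀ t : ℤ, ∃ c c', (φ.PastLimit ω c [] ∧ φ.PastLimit ω c' [] ∧ c < c' ∧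
        ∀ n, φ.PastLimit ω n [] → n ≤ c ∨ c' ≤ n) ∧ 2 * c ≤ t ∧ t < 2 * c' := by
      intro t
      obtain ⟨a, ha, ha'⟩ := h.exists_lt (t / 2)
      obtain ⟨a', hb, hb'⟩ := h.exists_gt (t / 2)
      obtain ⟨c, ⟨hc, hct⟩, hcmax⟩ := Int.exists_greatest_of_bdd
        (P := fun n => φ.PastLimit ω n [] ∧ n ≤ t / 2) ⟨t / 2, fun z hz => hz.2⟩ ⟨a, ha', ha.le⟩
      obtain ⟨c', ⟨hc', hct'⟩, hcmin⟩ := Int.exists_least_of_bdd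
        (P := fun n => φ.PastLimit ω n [] ∧ t / 2 < n) ⟨t / 2, fun z hz => hz.2.le⟩ ⟨a', hb', hb⟩
      refine ⟨c, c', ⟨hc, hc', by omega, fun n hn => ?_⟩, by omega, by omega⟩
      rcases le_or_gt n (t / 2) with hnt | hnt
      · exact Or.inl (hcmax n ⟨hn, hnt⟩)
      · exact Or.inr (hcmin n ⟨hn, hnt⟩)
    rintro ⟨hne, hs | hs⟩
    · obtain ⟨c, c', hcc', h1, h2⟩ := hcons t
      refine ⟨c, c', hcc', fun h => hne (Sum.inr_injective h), Or.inr ⟨(t - 2 * c).toNat, ?_⟩⟩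
      have ht : 2 * c + ((t - 2 * c).toNat : ℤ) = t := by omega
      rw [hsel c hcc'.1, ht]
      exact ⟨h2, rfl, s, rfl, hs⟩
    · obtain ⟨c, c', hcc', h1, h2⟩ := hcons s
      refine ⟨c, c', hcc', fun h => hne (Sum.inr_injective h), Or.inl ⟨(s - 2 * c).toNat, ?_⟩⟩
      have ht : 2 * c + ((s - 2 * c).toNat : ℤ) = s := by omega
      rw [hsel c hcc'.1, ht]
      exact ⟨h2, rfl, t, rfl, hs⟩

theorem Policy.IsGoodInput.exists_lt_eq_nil (h : φ.IsGoodInput ω) {L : ℤ → List ℤ}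
    (hnil : ∀ c, φ.PastLimit ω c [] → L (2 * c) = []) (m : ℤ) : ∃ c < m, L (2 * c) = [] := by
  obtain ⟨c, hc, hc'⟩ := h.exists_lt m
  exact ⟨c, hc, hnil c hc'⟩

theorem Policy.IsGoodInput.isBiinfiniteMatching (h : φ.IsGoodInput ω) :
    φ.IsBiinfiniteMatching ω (φ.stationaryMatching φ.limitBuffer ω) := by
  obtain ⟨L, hL, hnil⟩ := h.exists_isTrajectory
  rw [h.stationaryMatching_eq hL hnil]
  exact hL.isBiinfiniteMatching (h.exists_lt_eq_nil hnil)

theorem Policy.IsGoodInput.isPerfect (h : φ.IsGoodInput ω) :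
    IsPerfect (φ.stationaryMatching φ.limitBuffer ω) := by
  obtain ⟨L, hL, hnil⟩ := h.exists_isTrajectory
  rw [h.stationaryMatching_eq hL hnil]
  refine hL.isPerfect (fun m => ?_) (fun m => ?_)
  · obtain ⟨c, hc, hc'⟩ := h.exists_lt (min m 0)
    exact ⟨2 * c, by omega, hnil c hc'⟩
  · obtain ⟨c, hc, hc'⟩ := h.exists_gt (max m 0)
    exact ⟨2 * c, by omega, hnil c hc'⟩

/-- A bi-infinite matching whose buffer is not transient at `-∞` is the matching built on the
construction points: its buffer content is that of the systems started empty in a remote past, so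
its buffer is empty at the construction points. -/
theorem Policy.IsGoodInput.eq_stationaryMatching [Finite V] (h : φ.IsGoodInput ω)
    {H : SimpleGraph ℤ} (hH : φ.IsBiinfiniteMatching ω H)
    (ht : ¬ Tendsto (fun n : ℕ => (storedList H (2 * (-(n : ℤ)))).length) atTop atTop) :
    H = φ.stationaryMatching φ.limitBuffer ω := by
  have hlim := h.pastLimit_of_not_tendsto (u := fun n => itemClasses ω (storedList H (2 * n)))
    hH.itemClasses_mem (fun n => by simpa [Policy.flow] using hH.isTrajectory.itemClasses_eq_flow n 1)
    (by simpa [itemClasses] using ht)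
  rw [h.stationaryMatching_eq hH.isTrajectory fun c hc =>
    itemClasses_eq_nil.1 ((hlim c).unique hc)]
  exact hH.eq_matchGraph

/-- If the systems started at the times `-k` with the contents `y k` become empty before any given
time, then their matchings coincide with the stationary one from any given time on, for `k`
large. -/
theorem Policy.IsGoodInput.eventually_infiniteMatching_adj (h : φ.IsGoodInput ω)
    {y : ℕ → List V} (hy : ∀ j : ℤ, ∀ᶠ k : ℕ in atTop,
      ∃ i : ℕ, 0 < i ∧ -(k : ℤ) + i ≤ j ∧ φ.flow ω (-k) (y k) i = []) (m : ℤ) :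
    ∀ᶠ k : ℕ in atTop, ∀ t : ℤ, 2 * m ≤ t → ∀ x : Node,
      (φ.infiniteMatching (y k) (-(k : ℤ)) ω).Adj x (Sum.inr t) ↔
        ∃ s : ℤ, x = Sum.inr s ∧ (φ.stationaryMatching φ.limitBuffer ω).Adj s t := by
  obtain ⟨L, hL, hnil⟩ := h.exists_isTrajectory
  rw [h.stationaryMatching_eq hL hnil]
  obtain ⟨c, hc, hc'⟩ := h.exists_lt m
  obtain ⟨N, hN⟩ := eventually_atTop.1 hc'
  filter_upwards [hy (c - N)] with k hk t hmt x
  obtain ⟨i, -, hi, hi'⟩ := hk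
  -- at the construction point `c`, the system started at time `-k` is empty
  have hflow : φ.flow ω (-k) (y k) (c + k).toNat = [] := by
    have := hN (c + k - i).toNat (by omega)
    rw [show c - ((c + k - i).toNat : ℤ) = -k + i by omega, ← hi', ← φ.flow_add,
      show i + (c + k - i).toNat = (c + k).toNat by omega, hi'] at this
    exact this
  have hbuf : ∀ j : ℕ, 2 * c ≤ 2 * (-(k : ℤ)) + j →
      φ.labelledBuffer (y k) (-k) ω j = labelled ω (L (2 * (-(k : ℤ)) + j)) := by
    intro j hj
    obtain ⟨l, rfl⟩ : ∃ l, j = 2 * (c + k).toNat + l := ⟨j - 2 * (c + k).toNat, by omega⟩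
    refine hL.labelledBuffer_eq ?_ ?_ l
    · rw [← φ.map_snd_labelledBuffer, List.map_eq_nil_iff] at hflow
      exact hflow
    · rw [show 2 * (-(k : ℤ)) + ((2 * (c + k).toNat : ℕ) : ℤ) = 2 * c by omega]
      exact hnil c hc'
  have hsel : ∀ (j : ℕ) (z : Node), 2 * c ≤ 2 * (-(k : ℤ)) + j →
      (φ.MatchedUponArrival (y k) (-k) ω j z ↔ ∃ s, z = Sum.inr s ∧
        φ.Selects ω (L (2 * (-(k : ℤ)) + j)) (2 * (-(k : ℤ)) + j) s) :=
    fun j z hj => Policy.matchedUponArrival_iff (hbuf j hj)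
  rw [Policy.infiniteMatching_adj]
  simp only [Policy.matchGraph, SimpleGraph.fromRel_adj]
  constructor
  · rintro ⟨hne, ⟨j, rfl, hj⟩ | ⟨j, ht, hj⟩⟩
    · have hlt : t < 2 * (-(k : ℤ)) + j := by
        obtain ⟨_, _, hmem⟩ := hj
        exact Policy.lt_of_mem_labelledBuffer (List.mem_of_getElem? hmem)
      obtain ⟨s, hs, hs'⟩ := (hsel j _ (by omega)).1 hj
      obtain rfl := Sum.inr_injective hs
      exact ⟨_, rfl, hlt.ne', Or.inr hs'⟩
    · obtain rfl := Sum.inr_injective ht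
      obtain ⟨s, rfl, hs'⟩ := (hsel j _ (by omega)).1 hj
      exact ⟨s, rfl, fun h => hne (by rw [h]), Or.inl hs'⟩
  · rintro ⟨s, rfl, hne, hs | hs⟩
    · refine ⟨fun h => hne (Sum.inr_injective h), Or.inr ⟨(t + 2 * k).toNat, ?_⟩⟩
      have ht : 2 * (-(k : ℤ)) + ((t + 2 * k).toNat : ℤ) = t := by omega
      rw [hsel _ _ (by omega), ht]
      exact ⟨rfl, s, rfl, hs⟩
    · have hts := hL.lt_of_mem _ _ hs.mem
      refine ⟨fun h => hne (Sum.inr_injective h), Or.inl ⟨(s + 2 * k).toNat, ?_⟩⟩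
      have ht : 2 * (-(k : ℤ)) + ((s + 2 * k).toNat : ℤ) = s := by omega
      rw [hsel _ _ (by omega), ht]
      exact ⟨rfl, t, rfl, hs⟩

end Good


/-! ### Compatibility with the shift -/

section Shift

variable {V : Type*} {G : SimpleGraph V} {φ : Policy G} {ω : Input G}

theorem itemAt_shift_one (ω : Input G) (t : ℤ) : itemAt (shift 1 ω) t = itemAt ω (t + 2) := by
  have h1 : (t + 2) / 2 = t / 2 + 1 := by omega
  have h2 : Even (t + 2) ↔ Even t := by simp
  simp only [itemAt, shift, h1, h2]

theorem itemClasses_shift_one (b : List ℤ) :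
    itemClasses (shift 1 ω) (b.map (· - 2)) = itemClasses ω b := by
  simp [itemClasses, itemAt_shift_one]

theorem Policy.selects_shift_one {b : List ℤ} {s t : ℤ} :
    φ.Selects (shift 1 ω) (b.map (· - 2)) t s ↔ φ.Selects ω b (t + 2) (s + 2) := by
  rw [Policy.Selects, itemClasses_shift_one, itemAt_shift_one, Policy.Selects]
  simp only [List.getElem?_map, Option.map_eq_some_iff, sub_eq_iff_eq_add, exists_eq_right]

theorem Policy.labelStep_shift_one (b : List ℤ) (t : ℤ) :
    φ.labelStep (shift 1 ω) (b.map (· - 2)) t = (φ.labelStep ω b (t + 2)).map (· - 2) := by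
  have hw : itemClasses (shift 1 ω) (b.map (· - 2)) = itemClasses ω b := itemClasses_shift_one b
  rcases hc : φ.choice (itemClasses ω b) (itemAt ω (t + 2)).1 (itemAt ω (t + 2)).2 with _ | i
  · rw [Policy.labelStep_of_none rfl hc,
      Policy.labelStep_of_none hw (by rwa [itemAt_shift_one])]
    simp
  · rw [Policy.labelStep_of_some rfl hc,
      Policy.labelStep_of_some hw (by rwa [itemAt_shift_one]), List.eraseIdx_map]

theorem Policy.IsTrajectory.shift_one {L : ℤ → List ℤ} (hL : φ.IsTrajectory ω L) :
    φ.IsTrajectory (shift 1 ω) fun t => (L (t + 2)).map (· - 2) := by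
  refine ⟨fun t => ?_, fun t s hs => ?_, fun t => ?_⟩
  · rw [List.pairwise_map]
    exact (hL.pairwise _).imp fun h => by omega
  · obtain ⟨r, hr, rfl⟩ := List.mem_map.1 hs
    have := hL.lt_of_mem _ _ hr
    omega
  · rw [Policy.labelStep_shift_one, ← hL.step, add_right_comm]

theorem Policy.IsGoodInput.stationaryMatching_shift_one (h : φ.IsGoodInput ω)
    (h' : φ.IsGoodInput (shift 1 ω)) (s t : ℤ) :
    (φ.stationaryMatching φ.limitBuffer (shift 1 ω)).Adj s t ↔
      (φ.stationaryMatching φ.limitBuffer ω).Adj (s + 2) (t + 2) := by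
  obtain ⟨L, hL, hnil⟩ := h.exists_isTrajectory
  rw [h.stationaryMatching_eq hL hnil, h'.stationaryMatching_eq hL.shift_one fun c hc => ?_]
  · simp [Policy.matchGraph, SimpleGraph.fromRel_adj, Policy.selects_shift_one]
  · rw [Policy.pastLimit_shift] at hc
    rw [show 2 * c + 2 = 2 * (c + 1) by ring, hnil _ hc, List.map_nil]

end Shift

/-! ### Measurability of the matchings -/

section Measurability

theorem measurableSet_of_fibres {Ω α β : Type*} [MeasurableSpace Ω] [Countable α]
    [MeasurableSpace β] [DiscreteMeasurableSpace β] {A : Ω → α} {x : Ω → β}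
    (hA : ∀ a, MeasurableSet {ω | A ω = a}) (hx : Measurable x) (p : α → β → Prop) :
    MeasurableSet {ω | p (A ω) (x ω)} := by
  have : {ω | p (A ω) (x ω)} = ⋃ a, {ω | A ω = a} ∩ x ⁻¹' {b | p a b} := by
    ext ω; simp
  rw [this]
  exact MeasurableSet.iUnion fun a => (hA a).inter (hx MeasurableSet.of_discrete)

variable {V : Type*} [MeasurableSpace V] {G : SimpleGraph V} (φ : Policy G)

theorem measurable_itemAt (t : ℤ) : Measurable fun ω : Input G => itemAt ω t := by
  unfold itemAt
  split_ifs
  · exact (measurable_pi_apply _).fst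
  · exact (measurable_pi_apply _).snd

variable [Finite V] [DiscreteMeasurableSpace V]

theorem measurableSet_labelledBuffer (y : List V) (m : ℤ) (j : ℕ) (b : List (Node × V)) :
    MeasurableSet {ω | φ.labelledBuffer y m ω j = b} := by
  induction j generalizing b with
  | zero =>
    simp only [Policy.labelledBuffer]
    exact MeasurableSet.const _
  | succ j ih =>
    exact measurableSet_of_fibres ih (measurable_itemAt (2 * m + j))
      fun (a : List (Node × V)) (x : Item G) =>
        (match φ.choice (a.map Prod.snd) x.1 x.2 with
          | none => a ++ [(Sum.inr (2 * m + j), x.1)]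
          | some i => a.eraseIdx i) = b

theorem measurableSet_matchedUponArrival (y : List V) (m : ℤ) (j : ℕ) (z : Node) :
    MeasurableSet {ω | φ.MatchedUponArrival y m ω j z} :=
  measurableSet_of_fibres (measurableSet_labelledBuffer φ y m j) (measurable_itemAt (2 * m + j))
    fun (a : List (Node × V)) (x : Item G) =>
      ∃ i : Fin (a.map Prod.snd).length, φ.choice (a.map Prod.snd) x.1 x.2 = some i ∧
        (a.map Prod.fst)[(i : ℕ)]? = some z

theorem measurableSet_finiteMatching (y : List V) (m n : ℤ) (x z : Node) :
    MeasurableSet {ω | (φ.finiteMatching y m n ω).Adj x z} := by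
  simp only [Policy.finiteMatching_adj]
  have h := fun j z => measurableSet_setOfPred.1 (measurableSet_matchedUponArrival φ y m j z)
  refine measurableSet_setOfPred.2 (measurable_const.and ((Measurable.exists fun j =>
    measurable_const.and (measurable_const.and (h j z))).or (Measurable.exists fun j =>
    measurable_const.and (measurable_const.and (h j x)))))

theorem measurableSet_stationaryMatching {U : Input G → List V} (hU : IsQueueRV U) (s t : ℤ) :
    MeasurableSet {ω | (φ.stationaryMatching U ω).Adj s t} := by
  have hcp : ∀ n, Measurable fun ω => n ∈ constructionPoints U ω := fun n =>
    measurableSet_setOfPred.1 (measurable_shift n (hU.1 []))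
  simp only [Policy.stationaryMatching, SimpleGraph.iSup_adj, SimpleGraph.comap_adj, exists_prop]
  refine measurableSet_setOfPred.2 (Measurable.exists fun c => Measurable.exists fun c' =>
    Measurable.and ((hcp c).and ((hcp c').and (measurable_const.and (Measurable.forall fun n =>
      (hcp n).imp measurable_const)))) ?_)
  exact measurableSet_setOfPred.1 (measurableSet_finiteMatching φ _ _ _ _ _)

end Measurability

/-! ### Stationary matchings are not transient in the past -/

section Stationary

variable {V : Type*} [MeasurableSpace V] {G : SimpleGraph V} {μ : PMF V} {φ : Policy G}

/-- The number of items stored at time `-k` in a stationary matching is almost surely the number of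
items stored at time `0` for the input shifted by `-k`. -/
theorem Policy.IsStationaryPerfectMatching.ae_length_storedList {M : Input G → SimpleGraph ℤ}
    (hM : φ.IsStationaryPerfectMatching μ M) : ∀ᵐ ω ∂(inputLaw μ φ), ∀ k : ℕ,
      (storedList (M ω) (2 * (-(k : ℤ)))).length
        = (storedList (M (shift (-k) ω)) 0).length := by
  filter_upwards [ae_forall_shift hM.stationary] with ω hω k
  have hadj : ∀ (k : ℕ) (s t : ℤ),
      (M (shift (-k) ω)).Adj s t ↔ (M ω).Adj (s - 2 * k) (t - 2 * k) := by
    intro k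
    induction k with
    | zero => simp [shift_zero]
    | succ k ih =>
      intro s t
      have := hω (-(k + 1 : ℕ)) (s - 2) (t - 2)
      rw [shift_shift, sub_add_cancel, sub_add_cancel] at this
      rw [← this, show (1 : ℤ) + -((k + 1 : ℕ) : ℤ) = -k by push_cast; ring, ih]
      push_cast
      ring_nf
  have himage : stored (M ω) (2 * (-(k : ℤ)))
      = (fun s => s - 2 * (k : ℤ)) '' stored (M (shift (-k) ω)) 0 := by
    ext s
    simp only [stored, Set.mem_ofPred_eq, Set.mem_image, hadj]
    constructor
    · rintro ⟨hs, hs'⟩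
      exact ⟨s + 2 * k, ⟨by omega, fun r hr => by simpa using hs' (r - 2 * k) (by omega)⟩, by ring⟩
    · rintro ⟨s, ⟨hs, hs'⟩, rfl⟩
      exact ⟨by omega, fun r hr => by simpa using hs' (r + 2 * k) (by omega)⟩
  rw [length_storedList, length_storedList, himage,
    Set.ncard_image_of_injective _ (sub_left_injective)]

/-- By Poincaré recurrence, the buffer of a stationary matching is not transient at `-∞`. -/
theorem Policy.IsStationaryPerfectMatching.ae_not_tendsto {M : Input G → SimpleGraph ℤ}
    (hM : φ.IsStationaryPerfectMatching μ M) : ∀ᵐ ω ∂(inputLaw μ φ),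
      ¬ Tendsto (fun n : ℕ => (storedList (M ω) (2 * (-(n : ℤ)))).length) atTop atTop := by
  have hmeas : ∀ F : Finset ℤ, MeasurableSet {ω | stored (M ω) 0 = (F : Set ℤ)} := by
    intro F
    simp only [Set.ext_iff, stored, Set.mem_ofPred_eq]
    exact measurableSet_setOfPred.2 (Measurable.forall fun s => Measurable.iff
      (measurable_const.and (Measurable.forall fun r => measurable_const.imp
        (measurableSet_setOfPred.1 (hM.measurable s r)).not)) measurable_const)
  have hrec := ae_all_iff.2 fun F : Finset ℤ =>
    ae_frequently_shift_mem (μ := μ) (φ := φ) (hmeas F) (-1)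
  filter_upwards [hrec, hM.isBiinfiniteMatching, hM.ae_length_storedList] with ω hω hbi hlen ht
  have hF := hω (hbi.finite_stored 0).toFinset (by simp)
  obtain ⟨k, hk, hk'⟩ := (hF.and_eventually (ht.eventually
    (eventually_gt_atTop (hbi.finite_stored 0).toFinset.card))).exists
  rw [mul_neg_one] at hk
  rw [hlen, length_storedList, show stored (M (shift (-(k : ℤ)) ω)) 0 = _ from hk,
    Set.ncard_coe_finset] at hk'
  exact lt_irrefl _ hk'

end Stationary

end StochMatching

theorem theorem2 {V : Type*} [Finite V] [MeasurableSpace V] [DiscreteMeasurableSpace V]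
    (G : SimpleGraph V) (hG : G.Connected)
    (μ : PMF V) (hμ : ∀ v : V, v ∈ μ.support)
    (φ : StochMatching.Policy G) (hφ : φ.SubAdditive)
    (hH1 : ∀ Y : StochMatching.Input G → List V,
      StochMatching.IsBoundedQueueRV Y → φ.H1 μ Y) :
    ∃ M : StochMatching.Input G → SimpleGraph ℤ,
      -- existence
      φ.IsStationaryPerfectMatching μ M ∧
      -- uniqueness, among the stationary ones
      (∀ M' : StochMatching.Input G → SimpleGraph ℤ, φ.IsStationaryPerfectMatching μ M' →
        ∀ᵐ ω ∂(StochMatching.inputLaw μ φ), M' ω = M ω) ∧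
      -- uniqueness, for almost every input, among all those whose buffer does not explode at -∞
      (∀ᵐ ω ∂(StochMatching.inputLaw μ φ), ∀ H : SimpleGraph ℤ,
        φ.IsBiinfiniteMatching ω H → StochMatching.IsPerfect H →
        ¬ Tendsto (fun n : ℕ => (StochMatching.storedList H (2 * (-(n : ℤ)))).length)
            atTop atTop →
        H = M ω) ∧
      -- it is the matching that is built from the construction points of the unique stationary
      -- even buffer content
      (∃ U : StochMatching.Input G → List V,
        φ.IsStationaryBuffer μ U ∧
        (∀ U' : StochMatching.Input G → List V, φ.IsStationaryBuffer μ U' →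
          ∀ᵐ ω ∂(StochMatching.inputLaw μ φ), U' ω = U ω) ∧
        (∀ᵐ ω ∂(StochMatching.inputLaw μ φ), ∀ m : ℤ,
          (∃ n ∈ StochMatching.constructionPoints U ω, n < m) ∧
          (∃ n ∈ StochMatching.constructionPoints U ω, m < n)) ∧
        (∀ᵐ ω ∂(StochMatching.inputLaw μ φ), M ω = φ.stationaryMatching U ω)) ∧
      -- it is the limit, as k → ∞, of the infinite matchings that start from Y at time -k:
      -- for k large, all the items that enter from time m on have the same match in both
      (∀ Y : StochMatching.Input G → List V, StochMatching.IsQueueRV Y → φ.H1 μ Y →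
        ∀ᵐ ω ∂(StochMatching.inputLaw μ φ), ∀ m : ℤ, ∀ᶠ k : ℕ in atTop,
          ∀ t : ℤ, 2 * m ≤ t → ∀ x : StochMatching.Node,
            (φ.infiniteMatching (Y (StochMatching.shift (-(k : ℤ)) ω)) (-(k : ℤ)) ω).Adj
                x (Sum.inr t) ↔
              ∃ s : ℤ, x = Sum.inr s ∧ (M ω).Adj s t) := by
  have hgood := StochMatching.Policy.ae_isGoodInput hG hμ hφ hH1
  refine ⟨φ.stationaryMatching φ.limitBuffer, ⟨?_, ?_, ?_, ?_⟩, ?_, ?_,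
    ⟨φ.limitBuffer, StochMatching.Policy.isStationaryBuffer_limitBuffer hgood,
      fun U' hU' => hU'.ae_eq_limitBuffer hgood, ?_, ?_⟩, ?_⟩
  · exact StochMatching.measurableSet_stationaryMatching φ (StochMatching.isQueueRV_limitBuffer φ)
  · exact hgood.mono fun ω hω => hω.isBiinfiniteMatching
  · exact hgood.mono fun ω hω => hω.isPerfect
  · filter_upwards [hgood, StochMatching.ae_forall_shift hgood] with ω hω hω'
    exact hω.stationaryMatching_shift_one (hω' 1)
  · intro M' hM'
    filter_upwards [hgood, hM'.isBiinfiniteMatching, hM'.ae_not_tendsto] with ω hω h1 h2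
    exact hω.eq_stationaryMatching h1 h2
  · filter_upwards [hgood] with ω hω H hH _ ht
    exact hω.eq_stationaryMatching hH ht
  · filter_upwards [hgood] with ω hω m
    obtain ⟨n, hn, hn'⟩ := hω.exists_lt m
    obtain ⟨n', hm, hm'⟩ := hω.exists_gt m
    exact ⟨⟨n, hω.mem_constructionPoints.2 hn', hn⟩, ⟨n', hω.mem_constructionPoints.2 hm', hm⟩⟩
  · exact Eventually.of_forall fun ω => rfl
  · intro Y hY hYH1
    filter_upwards [hgood, hYH1.ae_eventually_empty hY] with ω hω hω' m
    exact hω.eventually_infiniteMatching_adj hω' m
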